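/- **Setting.** Messages are built from variables (names) and *located aliases* $\alpha=s\lambda$ ($s\in\{0,1\}^*$, $\lambda$ an alias variable) with the function symbols $\langle\cdot,\cdot\rangle$, $\mathsf{fst}$, $\mathsf{snd}$, $\{\cdot\}_{\cdot}$ (symmetric encryption), $\mathsf{dec}$, $\mathsf{mac}$; equality $=_E$ is the congruence generated by $\mathsf{fst}\langle M,N\rangle=M$, $\mathsf{snd}\langle M,N\rangle=N$, $\mathsf{dec}(\{M\}_K,K)=M$. Processes are those of the applied $\pi$-calculus with guarded choice ($0$, $\nu x.P$, $P\mid Q$, $M(x).P$, $\overline{M}\langle N\rangle.P$, $[M=N]P$, $G+H$, $!P$); an extended process is $\nu\vec x.(\sigma\mid P)$ with $\sigma$ an active substitution of messages for finitely many aliases, its domain being written $\mathrm{dom}$, and a process $P$ stands for $\mathrm{id}\mid P$. Transitions $A\xrightarrow{\pi}_u A'$ are given by the early located structural operational semantics: $\pi$ is an input $M\,N$, an output $\overline M(\alpha)$ (where $\alpha$ is a fresh alias carrying the location of the output) or $\tau$, the messages in $\pi$ contain no private name of $A$ and only aliases in $\mathrm{dom}(A)$, and $u$ is the location of the action. Write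 $\nu\vec x.(\sigma\mid P)\vDash M=N$ if $M\sigma=_E N\sigma$, the $\vec x$ being fresh for $M,N$. A family of relations $A\mathrel{\mathcal R^\rho}B$, with $\rho:\mathrm{dom}(A)\to\mathrm{dom}(B)$ a bijection, is an *$i$-simulation* if $A\mathrel{\mathcal R^\rho}B$ implies: (1) if $A\xrightarrow{\pi}_u A'$ with $\pi$ not an output, then $B\xrightarrow{\pi\rho}_{u'}B'$ and $A'\mathrel{\mathcal R^\rho}B'$ for some $B',u'$; (2) if $A\xrightarrow{\overline M(\alpha)}_uA'$, then $B\xrightarrow{\overline{M\rho}(\alpha')}_{u'}B'$ and $A'\mathrel{\mathcal R^{\rho[\alpha\mapsto\alpha']}}B'$ for some $B',u',\alpha'$; (3) $A\vDash M=N$ iff $B\vDash M\rho=N\rho$, for all messages $M,N$ over the aliases in $\mathrm{dom}(A)$. $A$ and $B$ are *$i$-bisimilar* if $A\mathrel{\mathcal R^{\mathrm{id}}}B$ for an $i$-simulation $\mathcal R$ that is symmetric ($A\mathrel{\mathcal R^\rho}B$ iff $B\mathrel{\mathcal R^{\rho^{-1}}}A$). Formulas of the modal logic $\mathcal{FM}$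 are built from $\mathtt{true}$, $M=N$, $\wedge$, $\neg$, $\langle\tau\rangle\phi$, $\langle M\,N\rangle\phi$ and $\langle\overline M(x)\rangle\phi$, where $A\vDash\langle\overline M(x)\rangle\phi$ if $A\xrightarrow{\overline M(\alpha)}_uB$ and $B\vDash\phi\{\alpha/x\}$ for some $B$, $u$ and some $\alpha$ fresh for $\phi$, and $A\vDash\langle\pi\rangle\phi$, for $\pi$ not an output, if $A\xrightarrow{\pi}_uB$ and $B\vDash\phi$ for some $B$, $u$; $[\pi]\phi=\neg\langle\pi\rangle\neg\phi$. The *simulation fragment* consists of the formulas in which negation is applied to equalities only. **Protocol.** The BAC protocol with silent authentication failure is given by $$P(c,d,ke,km)=\nu nt.\,\overline c\langle nt\rangle.\,d(y).\,[\mathsf{snd}(y)=\mathsf{mac}(\mathsf{fst}(y),km)]\,[nt=\mathsf{fst}(\mathsf{snd}(\mathsf{dec}(\mathsf{fst}(y),ke)))]\,\nu kt.\,\overline c\langle\langle m,\mathsf{mac}(m,km)\rangle\rangle$$ with $m=\{\langle nt,\langle\mathsf{fst}(\mathsf{dec}(\mathsf{fst}(y),ke)),kt\rangle\rangle\}_{ke}$,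 and $$V(c,d,ke,km)=d(nt).\,\nu nr.\,\nu kr.\,\overline c\langle\langle m',\mathsf{mac}(m',km)\rangle\rangle,\qquad m'=\{\langle nr,\langle nt,kr\rangle\rangle\}_{ke}.$$ For distinct public names $c\neq d$ let $$\mathrm{System}_{\min}=\,!\nu ke,km.\,!\big(V(c,d,ke,km)\mid P(c,d,ke,km)\big),\qquad \mathrm{Spec}_{\min}=\,!\nu ke,km.\big(V(c,d,ke,km)\mid P(c,d,ke,km)\big).$$ **Theorem.** $\mathrm{System}_{\min}$ and $\mathrm{Spec}_{\min}$ are not $i$-bisimilar. Moreover they are distinguished by an explicit formula: writing $\mathsf{pair}(x)$ for $\langle\mathsf{fst}(x),\mathsf{snd}(x)\rangle=x$ and, for a public name $z$, $$\beta(u)=\langle d\,u\rangle\langle\overline c(w)\rangle\big(\mathsf{pair}(w)\wedge[d\,z]\langle\overline c(v)\rangle\,\mathsf{pair}(v)\big),$$ $$\psi=\langle\overline c(nt_1)\rangle\langle d\,nt_1\rangle\langle d\,nt_1\rangle\langle\overline c(u_1)\rangle\langle\overline c(u_2)\rangle\big(\mathsf{pair}(u_1)\wedge\mathsf{pair}(u_2)\wedge\beta(u_1)\wedge\beta(u_2)\big),$$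 one has $\mathrm{System}_{\min}\vDash\psi$ and $\mathrm{Spec}_{\min}\nvDash\psi$; because of its box modalities, $\psi$ does not belong to the simulation fragment. -/

import Mathlib

/-
Applied pi-calculus with located aliases, interleaving bisimilarity, the modal logic FM, and the
minimal unbounded formulation of unlinkability for the BAC protocol.

Variables are de Bruijn indices: under `k` binders the indices `0, ..., k-1` denote the bound
variables (innermost first) and the index `k + i` denotes the `i`-th free variable (public name).
Thus processes are represented up to alpha-conversion, and a freshness condition
"`x` is fresh for ..." is expressed by shifting indices past the binder of `x`.
-/
namespace APi

/-! ### Messages and the equational theory -/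

/-- A located alias: an alias variable together with a location string. -/
structure Alias where
  loc : List Bool
  name : ℕ
deriving DecidableEq

/-- Messages over the signature of pairs, symmetric encryption and message authentication codes. -/
inductive Msg : Type
  | var (x : ℕ)
  | al (α : Alias)
  | pair (M N : Msg)
  | fst (M : Msg)
  | snd (M : Msg)
  | enc (M K : Msg)
  | dec (M K : Msg)
  | mac (M K : Msg)

/-- Simultaneous substitution of messages for variables. -/
def Msg.subst (s : ℕ → Msg) : Msg → Msg
  | .var x => s x
  | .al α => .al α
  | .pair M N => .pair (M.subst s) (N.subst s)
  | .fst M => .fst (M.subst s)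
  | .snd M => .snd (M.subst s)
  | .enc M K => .enc (M.subst s) (K.subst s)
  | .dec M K => .dec (M.subst s) (K.subst s)
  | .mac M K => .mac (M.subst s) (K.subst s)

/-- Simultaneous substitution of messages for aliases. -/
def Msg.asubst (σ : Alias → Msg) : Msg → Msg
  | .var x => .var x
  | .al α => σ α
  | .pair M N => .pair (M.asubst σ) (N.asubst σ)
  | .fst M => .fst (M.asubst σ)
  | .snd M => .snd (M.asubst σ)
  | .enc M K => .enc (M.asubst σ) (K.asubst σ)
  | .dec M K => .dec (M.asubst σ) (K.asubst σ)
  | .mac M K => .mac (M.asubst σ) (K.asubst σ)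

/-- Free aliases of a message. -/
def Msg.fal : Msg → Set Alias
  | .var _ => ∅
  | .al α => {α}
  | .pair M N => M.fal ∪ N.fal
  | .fst M => M.fal
  | .snd M => M.fal
  | .enc M K => M.fal ∪ K.fal
  | .dec M K => M.fal ∪ K.fal
  | .mac M K => M.fal ∪ K.fal

/-- Shift a message into the scope of `k` additional innermost binders. -/
def Msg.shift (k : ℕ) (M : Msg) : Msg := M.subst fun i => .var (i + k)

/-- Equality modulo the theory `E`: the least congruence with `fst (M, N) = M`, `snd (M, N) = N`
and `dec (enc (M, K), K) = M`. -/
inductive EqE : Msg → Msg → Prop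
  | fst_pair (M N) : EqE (.fst (.pair M N)) M
  | snd_pair (M N) : EqE (.snd (.pair M N)) N
  | dec_enc (M K) : EqE (.dec (.enc M K) K) M
  | refl (M) : EqE M M
  | symm {M N} : EqE M N → EqE N M
  | trans {M N K} : EqE M N → EqE N K → EqE M K
  | pair {M M' N N'} : EqE M M' → EqE N N' → EqE (.pair M N) (.pair M' N')
  | fst {M M'} : EqE M M' → EqE (.fst M) (.fst M')
  | snd {M M'} : EqE M M' → EqE (.snd M) (.snd M')
  | enc {M M' K K'} : EqE M M' → EqE K K' → EqE (.enc M K) (.enc M' K')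
  | dec {M M' K K'} : EqE M M' → EqE K K' → EqE (.dec M K) (.dec M' K')
  | mac {M M' K K'} : EqE M M' → EqE K K' → EqE (.mac M K) (.mac M' K')

/-! ### Processes -/

/-- Processes; `nu` and `inp` bind one variable in their continuation. -/
inductive Proc : Type
  | nil
  | nu (P : Proc)
  | par (P Q : Proc)
  | inp (M : Msg) (P : Proc)
  | out (M N : Msg) (P : Proc)
  | mat (M N : Msg) (P : Proc)
  | sum (P Q : Proc)
  | bang (P : Proc)

/-- Guarded processes, the only ones between which a choice is allowed. -/
inductive Guarded : Proc → Prop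
  | inp (M P) : Guarded (.inp M P)
  | out (M N P) : Guarded (.out M N P)
  | mat (M N) {G} : Guarded G → Guarded (.mat M N G)
  | sum {G H} : Guarded G → Guarded H → Guarded (.sum G H)
  | nu {G} : Guarded G → Guarded (.nu G)

/-- Extend a substitution: index `0` is sent to `N`, and the remaining indices follow `s`. -/
def scons (N : Msg) (s : ℕ → Msg) : ℕ → Msg
  | 0 => N
  | i + 1 => s i

/-- Push a substitution under one binder. -/
def up (s : ℕ → Msg) : ℕ → Msg := scons (.var 0) fun i => (s i).shift 1

/-- Capture-avoiding simultaneous substitution of messages for variables. -/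
def Proc.subst (s : ℕ → Msg) : Proc → Proc
  | .nil => .nil
  | .nu P => .nu (P.subst (up s))
  | .par P Q => .par (P.subst s) (Q.subst s)
  | .inp M P => .inp (M.subst s) (P.subst (up s))
  | .out M N P => .out (M.subst s) (N.subst s) (P.subst s)
  | .mat M N P => .mat (M.subst s) (N.subst s) (P.subst s)
  | .sum P Q => .sum (P.subst s) (Q.subst s)
  | .bang P => .bang (P.subst s)

/-- Renaming of indices. -/
def Proc.rename (f : ℕ → ℕ) (P : Proc) : Proc := P.subst fun i => .var (f i)

/-- Shift a process into the scope of `k` additional innermost binders. -/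
def Proc.shift (k : ℕ) (P : Proc) : Proc := P.rename (· + k)

/-- Replace the variable bound by an input by the message received. -/
def Proc.inst (N : Msg) (P : Proc) : Proc := P.subst (scons N .var)

/-! ### Extended processes -/

/-- Substitutions on aliases; the identity is `Msg.al`. -/
abbrev Subst := Alias → Msg

/-- The domain ignores the aliases that are mapped to themselves. -/
def Subst.dom (σ : Subst) : Set Alias := {α | σ α ≠ .al α}

/-- The substitution `{N/α}`. -/
def Subst.single (α : Alias) (N : Msg) : Subst := Function.update Msg.al α N

/-- Shift the range of an active substitution into the scope of `k` additional innermost binders;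
aliases outside the domain remain fixed. -/
def Subst.shift (k : ℕ) (σ : Subst) : Subst := fun α => (σ α).shift k

/-- `⟨n, σ, P⟩` is the extended process `ν x₁, ..., xₙ. (σ | P)`.
All those reachable from `⟨0, id, P⟩`, with `P` free of aliases, have an active substitution of
finite domain and alias-free range, and an alias-free process. -/
structure ExtProc where
  bound : ℕ
  frame : Subst
  proc : Proc

/-- `id | P`. -/
def ExtProc.ofProc (P : Proc) : ExtProc := ⟨0, Msg.al, P⟩

/-- `ν x. A`. -/
def ExtProc.nu (A : ExtProc) : ExtProc := ⟨A.bound + 1, A.frame, A.proc⟩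

def ExtProc.dom (A : ExtProc) : Set Alias := A.frame.dom

/-! ### Labels -/

/-- Early action labels: free input `M N`, output `M(α)`, interaction `τ`. -/
inductive Label : Type
  | inp (M N : Msg)
  | out (M : Msg) (α : Alias)
  | tau

def Label.IsOutput : Label → Prop
  | .out _ _ => True
  | _ => False

def Label.shift (k : ℕ) : Label → Label
  | .inp M N => .inp (M.shift k) (N.shift k)
  | .out M α => .out (M.shift k) α
  | .tau => .tau

/-- Free aliases of a label; the alias of an output does not count. -/
def Label.fal : Label → Set Alias
  | .inp M N => M.fal ∪ N.fal
  | .out M _ => M.fal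
  | .tau => ∅

/-- Apply an active substitution to the messages of a label that is not an output. -/
def Label.asubst (σ : Subst) : Label → Label
  | .inp M N => .inp (M.asubst σ) (N.asubst σ)
  | .out M α => .out (M.asubst σ) α
  | .tau => .tau

/-- A location `s[t]`: `s` records the parallel components, `t` the branches of choices. -/
structure Loc where
  pre : List Bool
  choice : List Bool

/-- Location labels: a location, or a pair (location of the output, location of the input). -/
inductive LocLabel : Type
  | one (l : Loc)
  | two (l₀ l₁ : Loc)

/-- Prepend `0` (`false`) or `1` (`true`) to a location. -/
def Loc.cons (b : Bool) (l : Loc) : Loc := ⟨b :: l.pre, l.choice⟩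

def LocLabel.cons (b : Bool) : LocLabel → LocLabel
  | .one l => .one (l.cons b)
  | .two l₀ l₁ => .two (l₀.cons b) (l₁.cons b)

/-- The alias `λ` with the empty location. -/
def rootAlias (l : ℕ) : Alias := ⟨[], l⟩

/-! ### Structural operational semantics -/

/-- Insert `k` binders just outside the `n` innermost ones. -/
def insertOutside (n k : ℕ) (i : ℕ) : ℕ := if i < n then i else i + k

/-- Exchange the block of the `n` innermost binders with the block of the `m` next ones. -/
def swapBlocks (n m : ℕ) (i : ℕ) : ℕ :=
  if i < n then i + m else if i < n + m then i - n else i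

/-- Early transitions of processes. -/
inductive PStep : Proc → Label → LocLabel → ExtProc → Prop
  | inp {M K : Msg} (N : Msg) (P : Proc) : EqE M K →
      PStep (.inp K P) (.inp M N) (.one ⟨[], []⟩) ⟨0, Msg.al, P.inst N⟩
  | out {M K : Msg} (N : Msg) (P : Proc) (l : ℕ) : EqE M K →
      PStep (.out K N P) (.out M (rootAlias l)) (.one ⟨[], []⟩)
        ⟨0, Subst.single (rootAlias l) N, P⟩
  | parL {P : Proc} {π u n σ R} (Q : Proc) : PStep P π u ⟨n, σ, R⟩ →
      PStep (.par P Q) π (u.cons false) ⟨n, σ, .par R (Q.shift n)⟩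
  | parR {Q : Proc} {π u n σ R} (P : Proc) : PStep Q π u ⟨n, σ, R⟩ →
      PStep (.par P Q) π (u.cons true) ⟨n, σ, .par (P.shift n) R⟩
  | ext {P : Proc} {π : Label} {u A} : PStep P (π.shift 1) u A → PStep (.nu P) π u A.nu
  | sumL {G H : Proc} {π t A} : Guarded G → Guarded H → PStep G π (.one ⟨[], t⟩) A →
      PStep (.sum G H) π (.one ⟨[], false :: t⟩) A
  | sumR {G H : Proc} {π t A} : Guarded G → Guarded H → PStep H π (.one ⟨[], t⟩) A →
      PStep (.sum G H) π (.one ⟨[], true :: t⟩) A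
  | mat {M N : Msg} {P : Proc} {π u A} : PStep P π u A → EqE M N → PStep (.mat M N P) π u A
  | bang {P : Proc} {π u A} : PStep (.par P (.bang P)) π u A → PStep (.bang P) π u A
  -- The message `N` lives in the scope of the `n` names extruded by the output.
  | closeL {P Q : Proc} {M N : Msg} {l n m : ℕ} {l₀ l₁ : Loc} {P' Q' : Proc} :
      PStep P (.out M (rootAlias l)) (.one l₀) ⟨n, Subst.single (rootAlias l) N, P'⟩ →
      PStep (Q.shift n) (.inp (M.shift n) N) (.one l₁) ⟨m, Msg.al, Q'⟩ →
      PStep (.par P Q) .tau (.two (l₀.cons false) (l₁.cons true))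
        ⟨n + m, Msg.al, .par (P'.shift m) Q'⟩
  -- The `n` names bound by the input side are placed outside the `m` names of the output side.
  | closeR {P Q : Proc} {M N : Msg} {l n m : ℕ} {l₀ l₁ : Loc} {P' Q' : Proc} :
      PStep (P.shift m) (.inp (M.shift m) N) (.one l₀) ⟨n, Msg.al, P'⟩ →
      PStep Q (.out M (rootAlias l)) (.one l₁) ⟨m, Subst.single (rootAlias l) N, Q'⟩ →
      PStep (.par P Q) .tau (.two (l₁.cons true) (l₀.cons false))
        ⟨n + m, Msg.al, .par (P'.rename (swapBlocks n m)) (Q'.rename (insertOutside m n))⟩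

/-- Early transitions of extended processes. -/
inductive Step : ExtProc → Label → LocLabel → ExtProc → Prop
  | aliasOut {P : Proc} {σ : Subst} {M N : Msg} {l m : ℕ} {s t : List Bool} {Q : Proc} :
      PStep P (.out (M.asubst σ) (rootAlias l)) (.one ⟨s, t⟩)
        ⟨m, Subst.single (rootAlias l) N, Q⟩ →
      M.fal ⊆ σ.dom → (⟨s, l⟩ : Alias) ∉ σ.dom →
      Step ⟨0, σ, P⟩ (.out M ⟨s, l⟩) (.one ⟨s, t⟩)
        ⟨m, Function.update (σ.shift m) ⟨s, l⟩ N, Q⟩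
  | aliasFree {P : Proc} {σ : Subst} {π : Label} {u : LocLabel} {m : ℕ} {Q : Proc} :
      ¬ π.IsOutput → PStep P (π.asubst σ) u ⟨m, Msg.al, Q⟩ → π.fal ⊆ σ.dom →
      Step ⟨0, σ, P⟩ π u ⟨m, σ.shift m, Q⟩
  | res {A B : ExtProc} {π : Label} {u : LocLabel} : Step A (π.shift 1) u B → Step A.nu π u B.nu

/-- `A ⊨ M = N`: shifting makes the private names of `A` fresh for `M` and `N`. -/
def ExtProc.SatEq (A : ExtProc) (M N : Msg) : Prop :=
  EqE ((M.shift A.bound).asubst A.frame) ((N.shift A.bound).asubst A.frame)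

/-! ### Interleaving similarity and bisimilarity -/

/-- The renaming of aliases given by a partial bijection `ρ`. -/
def aliasMap (ρ : Alias ≃. Alias) : Subst := fun α => .al ((ρ α).getD α)

/-- `ρ' = ρ[α ↦ α']`. -/
def IsUpdate (ρ : Alias ≃. Alias) (α α' : Alias) (ρ' : Alias ≃. Alias) : Prop :=
  ∀ β, ρ' β = if β = α then some α' else ρ β

/-- Relations between extended processes that are indexed by partial bijections of aliases. -/
abbrev IndexedRel := ExtProc → (Alias ≃. Alias) → ExtProc → Prop

/-- `i`-simulations. Static equivalence is tested by recipes over the aliases in the domain of `A`,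
the only ones on which `ρ` is defined. -/
structure IsISimulation (R : IndexedRel) : Prop where
  bij_dom : ∀ {A ρ B}, R A ρ B → {α | (ρ α).isSome} = A.dom
  bij_ran : ∀ {A ρ B}, R A ρ B → {α | (ρ.symm α).isSome} = B.dom
  nonOutput : ∀ {A ρ B π u A'}, R A ρ B → ¬ π.IsOutput → Step A π u A' →
    ∃ B' u', Step B (π.asubst (aliasMap ρ)) u' B' ∧ R A' ρ B'
  output : ∀ {A ρ B M α u A'}, R A ρ B → Step A (.out M α) u A' →
    ∃ B' u' α' ρ', Step B (.out (M.asubst (aliasMap ρ)) α') u' B' ∧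
      IsUpdate ρ α α' ρ' ∧ R A' ρ' B'
  static : ∀ {A ρ B M N}, R A ρ B → M.fal ⊆ A.dom → N.fal ⊆ A.dom →
    (A.SatEq M N ↔ B.SatEq (M.asubst (aliasMap ρ)) (N.asubst (aliasMap ρ)))

open Classical in
/-- The identity bijection of the domain of `A`. -/
noncomputable def idOn (A : ExtProc) : Alias ≃. Alias := PEquiv.ofSet A.dom

/-- `A` and `B` are `i`-bisimilar: a symmetric `i`-simulation relates them via the identity. -/
def IBisimilar (A B : ExtProc) : Prop :=
  ∃ R : IndexedRel, IsISimulation R ∧ (∀ A ρ B, R A ρ B ↔ R B ρ.symm A) ∧ R A (idOn A) B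

/-! ### The modal logic FM -/

/-- Formulas of FM; `diaOut M φ` is `⟨M(x)⟩φ` and binds the variable `x` in `φ`. -/
inductive Formula : Type
  | tt
  | eq (M N : Msg)
  | and (φ ψ : Formula)
  | neg (φ : Formula)
  | diaTau (φ : Formula)
  | diaInp (M N : Msg) (φ : Formula)
  | diaOut (M : Msg) (φ : Formula)

/-- `[M N]φ`. -/
def Formula.boxInp (M N : Msg) (φ : Formula) : Formula := .neg (.diaInp M N (.neg φ))

/-- The simulation fragment: negation is applied to equalities only. -/
def Formula.InSimulationFragment : Formula → Prop
  | .tt => True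
  | .eq _ _ => True
  | .and φ ψ => φ.InSimulationFragment ∧ ψ.InSimulationFragment
  | .neg (.eq _ _) => True
  | .neg _ => False
  | .diaTau φ => φ.InSimulationFragment
  | .diaInp _ _ φ => φ.InSimulationFragment
  | .diaOut _ φ => φ.InSimulationFragment

/-- Free aliases of the formula `φ` under the substitution `s`. -/
def Formula.falUnder : (ℕ → Msg) → Formula → Set Alias
  | _, .tt => ∅
  | s, .eq M N => (M.subst s).fal ∪ (N.subst s).fal
  | s, .and φ ψ => φ.falUnder s ∪ ψ.falUnder s
  | s, .neg φ => φ.falUnder s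
  | s, .diaTau φ => φ.falUnder s
  | s, .diaInp M N φ => (M.subst s).fal ∪ (N.subst s).fal ∪ φ.falUnder s
  | s, .diaOut M φ => (M.subst s).fal ∪ φ.falUnder (up s)

/-- `A ⊨ φ s`, where the substitution `s` records the aliases chosen for the variables bound by
the output modalities passed so far: the bound variable is replaced by the alias of the output,
which has to be fresh for the formula. -/
def SatUnder : (ℕ → Msg) → ExtProc → Formula → Prop
  | _, _, .tt => True
  | s, A, .eq M N => A.SatEq (M.subst s) (N.subst s)
  | s, A, .and φ ψ => SatUnder s A φ ∧ SatUnder s A ψ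
  | s, A, .neg φ => ¬ SatUnder s A φ
  | s, A, .diaTau φ => ∃ u B, Step A .tau u B ∧ SatUnder s B φ
  | s, A, .diaInp M N φ =>
      ∃ u B, Step A (.inp (M.subst s) (N.subst s)) u B ∧ SatUnder s B φ
  | s, A, .diaOut M φ =>
      ∃ α u B, Step A (.out (M.subst s) α) u B ∧ α ∉ φ.falUnder (up s) ∧
        SatUnder (scons (.al α) s) B φ

/-- `A ⊨ φ`. -/
def Sat (A : ExtProc) (φ : Formula) : Prop := SatUnder Msg.var A φ

/-! ### The BAC protocol, minimal unbounded style, silent failure -/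

open Msg in
/-- The ePassport
`ν nt. c⟨nt⟩. d(y). [snd y = mac(fst y, km)] [nt = fst (snd (dec(fst y, ke)))] ν kt. c⟨m, mac(m, km)⟩`
with `m = enc((nt, (fst (dec(fst y, ke)), kt)), ke)`. -/
def prover (c d ke km : ℕ) : Proc :=
  .nu <|
  -- now `nt = 0`
  .out (var (c + 1)) (var 0) <|
  .inp (var (d + 1)) <|
  -- now `y = 0`, `nt = 1`
  .mat (snd (var 0)) (mac (fst (var 0)) (var (km + 2))) <|
  .mat (var 1) (fst (snd (dec (fst (var 0)) (var (ke + 2))))) <|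
  .nu <|
  -- now `kt = 0`, `y = 1`, `nt = 2`
  let m := enc (pair (var 2) (pair (fst (dec (fst (var 1)) (var (ke + 3)))) (var 0)))
    (var (ke + 3))
  .out (var (c + 3)) (pair m (mac m (var (km + 3)))) .nil

open Msg in
/-- The reader `d(nt). ν nr. ν kr. c⟨m, mac(m, km)⟩` with `m = enc((nr, (nt, kr)), ke)`. -/
def verifier (c d ke km : ℕ) : Proc :=
  .inp (var d) <|
  .nu <|
  .nu <|
  -- now `kr = 0`, `nr = 1`, `nt = 2`
  let m := enc (pair (var 1) (pair (var 2) (var 0))) (var (ke + 3))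
  .out (var (c + 3)) (pair m (mac m (var (km + 3)))) .nil

/-- `! ν ke, km. ! (V(c, d, ke, km) | P(c, d, ke, km))`. -/
def systemMin (c d : ℕ) : Proc :=
  .bang <| .nu <| .nu <| .bang <|
    .par (verifier (c + 2) (d + 2) 1 0) (prover (c + 2) (d + 2) 1 0)

/-- `! ν ke, km. (V(c, d, ke, km) | P(c, d, ke, km))`. -/
def specMin (c d : ℕ) : Proc :=
  .bang <| .nu <| .nu <|
    .par (verifier (c + 2) (d + 2) 1 0) (prover (c + 2) (d + 2) 1 0)

/-! ### The attack formula -/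

/-- The test `(fst M, snd M) = M` that `M` is a pair. -/
def isPair (M : Msg) : Formula := .eq (.pair (.fst M) (.snd M)) M

/-- `⟨d u⟩⟨c(w)⟩(isPair w ∧ [d z]⟨c(v)⟩ isPair v)`. -/
def attackBranch (c d z u : ℕ) : Formula :=
  .diaInp (.var d) (.var u) <|
  .diaOut (.var c) <|
  -- now `w = 0`
  .and (isPair (.var 0)) <|
  .boxInp (.var (d + 1)) (.var (z + 1)) <|
  .diaOut (.var (c + 1)) <|
  -- now `v = 0`
  isPair (.var 0)

/-- `ψ = ⟨c(nt₁)⟩⟨d nt₁⟩⟨d nt₁⟩⟨c(u₁)⟩⟨c(u₂)⟩(isPair u₁ ∧ isPair u₂ ∧ branch u₁ ∧ branch u₂)`. -/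
def attackFormula (c d z : ℕ) : Formula :=
  .diaOut (.var c) <|
  -- now `nt₁ = 0`
  .diaInp (.var (d + 1)) (.var 0) <|
  .diaInp (.var (d + 1)) (.var 0) <|
  .diaOut (.var (c + 1)) <|
  .diaOut (.var (c + 2)) <|
  -- now `u₂ = 0`, `u₁ = 1`, `nt₁ = 2`
  .and (isPair (.var 1)) <| .and (isPair (.var 0)) <|
  .and (attackBranch (c + 3) (d + 3) (z + 3) 1) (attackBranch (c + 3) (d + 3) (z + 3) 0)

end APi

/-!
The attack formula separates the two processes because of the sessions that share their keys.

In the system, the prover of one session sends a nonce that the verifiers of two sessions with the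
same keys receive and answer. Its own prover accepts either answer, since it only checks the keys
and the nonce, and replies with a pair (`proverReply_step`). Afterwards no prover is waiting for an
input, so that any further input is consumed by some verifier, which answers with a pair
(`OnlyVerifiersReceive.canSendPair`); this gives the box modality and `systemMin_sat`.

In the specification every key belongs to a single verifier and a single prover. The relation `Rep`
abstracts a reachable process to the multiset of its agents, and `Rep.inp` and `Rep.out` determine
its transitions. Two answers to the nonce can come only from two verifiers with different keys
(`rejected_of_two_replies`), so the only waiting prover rejects one of them, say `u`. Then a pair
sent after the input of `u` comes from a verifier that has received `u`, and the prover is still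
waiting; it may consume the input tested by the box modality, after which no pair can be sent
(`Tracks.not_sat_attackBranch`).
Negative facts about equality modulo the theory are read off from normal forms (`EqE.nf_eq`).

That the processes are not `i`-bisimilar follows, as the logic is sound for `i`-bisimilarity
(`IBisimilar.sat`).
-/

namespace APi

/-! ### Messages: substitution and shifting -/

@[simp] theorem Msg.shift_var (k i : ℕ) : (Msg.var i).shift k = .var (i + k) := rfl
@[simp] theorem Msg.shift_al (k : ℕ) (α : Alias) : (Msg.al α).shift k = .al α := rfl
@[simp] theorem Msg.shift_pair (k : ℕ) (M N : Msg) :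
    (Msg.pair M N).shift k = .pair (M.shift k) (N.shift k) := rfl
@[simp] theorem Msg.shift_fst (k : ℕ) (M : Msg) : (Msg.fst M).shift k = .fst (M.shift k) := rfl
@[simp] theorem Msg.shift_snd (k : ℕ) (M : Msg) : (Msg.snd M).shift k = .snd (M.shift k) := rfl
@[simp] theorem Msg.shift_enc (k : ℕ) (M N : Msg) :
    (Msg.enc M N).shift k = .enc (M.shift k) (N.shift k) := rfl
@[simp] theorem Msg.shift_dec (k : ℕ) (M N : Msg) :
    (Msg.dec M N).shift k = .dec (M.shift k) (N.shift k) := rfl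
@[simp] theorem Msg.shift_mac (k : ℕ) (M N : Msg) :
    (Msg.mac M N).shift k = .mac (M.shift k) (N.shift k) := rfl

@[simp] theorem Msg.shift_shift (a b : ℕ) (M : Msg) : (M.shift a).shift b = M.shift (a + b) := by
  induction M <;> simp_all [Nat.add_assoc]

@[simp] theorem Msg.subst_var (M : Msg) : M.subst .var = M := by
  induction M <;> simp_all [Msg.subst]

@[simp] theorem Msg.shift_zero (M : Msg) : M.shift 0 = M := M.subst_var

@[simp] theorem Msg.fal_shift (k : ℕ) (M : Msg) : (M.shift k).fal = M.fal := by
  induction M <;> simp_all [Msg.fal]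

theorem Msg.subst_subst (s t : ℕ → Msg) (M : Msg) :
    (M.subst s).subst t = M.subst fun i => (s i).subst t := by
  induction M <;> simp_all [Msg.subst]

@[simp] theorem up_zero (s : ℕ → Msg) : up s 0 = .var 0 := rfl
@[simp] theorem up_succ (s : ℕ → Msg) (i : ℕ) : up s (i + 1) = (s i).shift 1 := rfl
@[simp] theorem scons_zero (N : Msg) (s : ℕ → Msg) : scons N s 0 = N := rfl
@[simp] theorem scons_succ (N : Msg) (s : ℕ → Msg) (i : ℕ) : scons N s (i + 1) = s i := rfl

@[simp] theorem up_var : up .var = .var := by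
  funext i
  cases i <;> rfl

@[simp] theorem Proc.subst_var (P : Proc) : P.subst .var = P := by
  induction P <;> simp_all [Proc.subst]

@[simp] theorem Proc.shift_zero (P : Proc) : P.shift 0 = P := P.subst_var

@[simp] theorem Proc.shift_nil (n : ℕ) : Proc.nil.shift n = .nil := rfl

@[simp] theorem Proc.shift_par (n : ℕ) (P Q : Proc) :
    (Proc.par P Q).shift n = .par (P.shift n) (Q.shift n) := rfl

@[simp] theorem Proc.shift_bang (n : ℕ) (P : Proc) :
    (Proc.bang P).shift n = .bang (P.shift n) := rfl

@[simp] theorem Label.shift_shift (a b : ℕ) (π : Label) :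
    (π.shift a).shift b = π.shift (a + b) := by
  cases π <;> simp [Label.shift]

@[simp] theorem Subst.shift_zero (σ : Subst) : σ.shift 0 = σ := by
  funext α
  simp [Subst.shift]

/-! ### Normal forms for the equational theory -/

open Classical in
/-- Normal forms of messages with respect to the rewrite rules obtained by orienting the three
equations from left to right. -/
noncomputable def Msg.nf : Msg → Msg
  | .var x => .var x
  | .al α => .al α
  | .pair M N => .pair M.nf N.nf
  | .fst M => match M.nf with
    | .pair A _ => A
    | T => .fst T
  | .snd M => match M.nf with
    | .pair _ B => B
    | T => .snd T
  | .enc M K => .enc M.nf K.nf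
  | .dec M K => match M.nf with
    | .enc A L => if L = K.nf then A else .dec (.enc A L) K.nf
    | T => .dec T K.nf
  | .mac M K => .mac M.nf K.nf

/-- Normal forms are a model of the equational theory; this refutes equations. -/
theorem EqE.nf_eq {M N : Msg} (h : EqE M N) : M.nf = N.nf := by
  induction h with
  | dec _ _ h₁ h₂ => simp only [Msg.nf]; rw [h₁, h₂]
  | _ => simp_all [Msg.nf]

/-! ### Inversion of transitions of processes -/

theorem PStep.not_nil {π u A} : ¬ PStep .nil π u A := by
  intro h
  cases h

theorem PStep.nu_inv {P π u A} (h : PStep (.nu P) π u A) :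
    ∃ B, A = B.nu ∧ PStep P (π.shift 1) u B := by
  cases h with
  | ext h => exact ⟨_, rfl, h⟩

theorem PStep.nu_nu_inv {P π u A} (h : PStep (.nu (.nu P)) π u A) :
    ∃ B, A = B.nu.nu ∧ PStep P (π.shift 2) u B := by
  obtain ⟨B, rfl, h₁⟩ := h.nu_inv
  obtain ⟨C, rfl, h₂⟩ := h₁.nu_inv
  exact ⟨C, rfl, by simpa using h₂⟩

theorem PStep.mat_inv {M N P π u A} (h : PStep (.mat M N P) π u A) :
    EqE M N ∧ PStep P π u A := by
  cases h with
  | mat h e => exact ⟨e, h⟩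

theorem PStep.inp_inv {K P π u A} (h : PStep (.inp K P) π u A) :
    ∃ M N, π = .inp M N ∧ A = ⟨0, Msg.al, P.inst N⟩ := by
  cases h with
  | inp N _ e => exact ⟨_, _, rfl, rfl⟩

theorem PStep.out_inv {K N P π u A} (h : PStep (.out K N P) π u A) :
    ∃ M l, π = .out M (rootAlias l) ∧ A = ⟨0, Subst.single (rootAlias l) N, P⟩ := by
  cases h with
  | out _ _ l e => exact ⟨_, _, rfl, rfl⟩

theorem PStep.par_inv {P Q π u A} (h : PStep (.par P Q) π u A) (hπ : π ≠ .tau) :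
    (∃ v n σ R, PStep P π v ⟨n, σ, R⟩ ∧ A = ⟨n, σ, .par R (Q.shift n)⟩) ∨
    (∃ v n σ R, PStep Q π v ⟨n, σ, R⟩ ∧ A = ⟨n, σ, .par (P.shift n) R⟩) := by
  cases h with
  | parL _ h => exact .inl ⟨_, _, _, _, h, rfl⟩
  | parR _ h => exact .inr ⟨_, _, _, _, h, rfl⟩
  | closeL => exact absurd rfl hπ
  | closeR => exact absurd rfl hπ

/-- A visible action of `!P` is an action of one copy of `P`, which runs in parallel with `!P`
and with the idle copies of `P` that the derivation has unfolded before. -/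
theorem PStep.bang_induction {P π u A} (h : PStep (.bang P) π u A) (hπ : π ≠ .tau)
    {C : ExtProc → Prop}
    (copy : ∀ v n σ R, PStep P π v ⟨n, σ, R⟩ → C ⟨n, σ, .par R ((Proc.bang P).shift n)⟩)
    (idle : ∀ n σ R, C ⟨n, σ, R⟩ → C ⟨n, σ, .par (P.shift n) R⟩) : C A := by
  generalize hT : Proc.bang P = T at h
  -- The two shapes of processes that occur in the derivation are treated simultaneously.
  have key : (T = .bang P → C A) ∧ (T = .par P (.bang P) → C A) := by
    clear hT
    induction h with
    | parL _ h ih =>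
      refine ⟨nofun, fun e => ?_⟩
      cases e
      exact copy _ _ _ _ h
    | parR _ h ih =>
      refine ⟨nofun, fun e => ?_⟩
      cases e
      exact idle _ _ _ ((ih hπ copy).1 rfl)
    | bang h ih =>
      refine ⟨fun e => ?_, nofun⟩
      cases e
      exact (ih hπ copy).2 rfl
    | closeL => exact absurd rfl hπ
    | closeR => exact absurd rfl hπ
    | _ => exact ⟨nofun, nofun⟩
  exact key.1 hT.symm

/-! ### Transitions of extended processes -/

/-- Outputs of `ν x₁, ..., xₙ. (σ | P)` in terms of outputs of `P`. -/
theorem step_out_iff {n σ P M α u B} :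
    Step ⟨n, σ, P⟩ (.out M α) u B ↔ ∃ t m N Q,
      PStep P (.out ((M.shift n).asubst σ) (rootAlias α.name)) (.one ⟨α.loc, t⟩)
        ⟨m, Subst.single (rootAlias α.name) N, Q⟩ ∧
      M.fal ⊆ σ.dom ∧ α ∉ σ.dom ∧ u = .one ⟨α.loc, t⟩ ∧
      B = ⟨m + n, Function.update (σ.shift m) α N, Q⟩ := by
  constructor
  · intro h
    generalize hA : (⟨n, σ, P⟩ : ExtProc) = A at h
    generalize hL : Label.out M α = π at h
    induction h generalizing n M with
    | aliasOut h hM hα =>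
      cases hA
      cases hL
      exact ⟨_, _, _, _, by simpa using h, hM, hα, rfl, rfl⟩
    | aliasFree hπ => cases hL; exact absurd trivial hπ
    | @res A B π u h ih =>
      cases n with
      | zero => simp [ExtProc.nu] at hA
      | succ n =>
        obtain ⟨b, τ, T⟩ := A
        simp only [ExtProc.nu, ExtProc.mk.injEq, Nat.add_right_cancel_iff] at hA
        obtain ⟨rfl, rfl, rfl⟩ := hA
        subst hL
        obtain ⟨t, m, N, Q, h1, h2, h3, h4, rfl⟩ := ih rfl rfl
        exact ⟨t, m, N, Q, by simpa [Nat.add_comm] using h1, by simpa using h2, h3, h4, rfl⟩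
  · rintro ⟨t, m, N, Q, h, hM, hα, rfl, rfl⟩
    induction n generalizing M with
    | zero => exact .aliasOut (by simpa using h) hM hα
    | succ n ih =>
      exact .res (A := ⟨n, σ, P⟩) (B := ⟨m + n, _, Q⟩)
        (ih (M := M.shift 1) (by simpa [Nat.add_comm] using h) (by simpa using hM))

/-- Inputs of `ν x₁, ..., xₙ. (σ | P)` in terms of inputs of `P`. -/
theorem step_inp_iff {n σ P M K u B} :
    Step ⟨n, σ, P⟩ (.inp M K) u B ↔ ∃ m Q,
      PStep P (.inp ((M.shift n).asubst σ) ((K.shift n).asubst σ)) u ⟨m, Msg.al, Q⟩ ∧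
      M.fal ∪ K.fal ⊆ σ.dom ∧ B = ⟨m + n, σ.shift m, Q⟩ := by
  constructor
  · intro h
    generalize hA : (⟨n, σ, P⟩ : ExtProc) = A at h
    generalize hL : Label.inp M K = π at h
    induction h generalizing n M K with
    | aliasOut => cases hL
    | aliasFree hπ h hf =>
      cases hA
      cases hL
      exact ⟨_, _, by simpa [Label.asubst] using h, hf, rfl⟩
    | @res A B π u h ih =>
      cases n with
      | zero => simp [ExtProc.nu] at hA
      | succ n =>
        obtain ⟨b, τ, T⟩ := A
        simp only [ExtProc.nu, ExtProc.mk.injEq, Nat.add_right_cancel_iff] at hA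
        obtain ⟨rfl, rfl, rfl⟩ := hA
        subst hL
        obtain ⟨m, Q, h1, h2, rfl⟩ := ih rfl rfl
        exact ⟨m, Q, by simpa [Nat.add_comm] using h1, by simpa using h2, rfl⟩
  · rintro ⟨m, Q, h, hM, rfl⟩
    induction n generalizing M K with
    | zero => exact .aliasFree (fun h => h) (by simpa [Label.asubst] using h) hM
    | succ n ih =>
      exact .res (A := ⟨n, σ, P⟩) (B := ⟨m + n, _, Q⟩)
        (ih (M := M.shift 1) (K := K.shift 1) (by simpa [Nat.add_comm] using h)
          (by simpa using hM))

/-! ### Bisimilar processes satisfy the same formulas -/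

/-- No alias occurs in the formula; aliases enter only through the variables bound by the output
modalities. -/
def Formula.AliasFree : Formula → Prop
  | .tt => True
  | .eq M N => M.fal = ∅ ∧ N.fal = ∅
  | .and φ ψ => φ.AliasFree ∧ ψ.AliasFree
  | .neg φ => φ.AliasFree
  | .diaTau φ => φ.AliasFree
  | .diaInp M N φ => M.fal = ∅ ∧ N.fal = ∅ ∧ φ.AliasFree
  | .diaOut M φ => M.fal = ∅ ∧ φ.AliasFree

theorem Msg.fal_subst_subset {s : ℕ → Msg} {D : Set Alias} (hs : ∀ i, (s i).fal ⊆ D) {M : Msg}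
    (hM : M.fal = ∅) : (M.subst s).fal ⊆ D := by
  induction M <;> simp_all [Msg.fal, Msg.subst]

theorem fal_up_subset {s : ℕ → Msg} {D : Set Alias} (hs : ∀ i, (s i).fal ⊆ D) (i : ℕ) :
    (up s i).fal ⊆ D := by
  cases i with
  | zero => simp [Msg.fal]
  | succ i => simpa using hs i

theorem Formula.falUnder_subset {φ : Formula} {s : ℕ → Msg} {D : Set Alias}
    (hs : ∀ i, (s i).fal ⊆ D) (hφ : φ.AliasFree) : φ.falUnder s ⊆ D := by
  induction φ generalizing s with
  | tt => simp [Formula.falUnder]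
  | eq M N =>
    exact Set.union_subset (Msg.fal_subst_subset hs hφ.1) (Msg.fal_subst_subset hs hφ.2)
  | and φ ψ h₁ h₂ => exact Set.union_subset (h₁ hs hφ.1) (h₂ hs hφ.2)
  | neg φ ih => exact ih hs hφ
  | diaTau φ ih => exact ih hs hφ
  | diaInp M N φ ih =>
    exact Set.union_subset (Set.union_subset (Msg.fal_subst_subset hs hφ.1)
      (Msg.fal_subst_subset hs hφ.2.1)) (ih hs hφ.2.2)
  | diaOut M φ ih =>
    exact Set.union_subset (Msg.fal_subst_subset hs hφ.1) (ih (fal_up_subset hs) hφ.2)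

theorem Msg.asubst_subst (s : ℕ → Msg) (σ : Subst) {M : Msg} (hM : M.fal = ∅) :
    (M.subst s).asubst σ = M.subst fun i => (s i).asubst σ := by
  induction M <;> simp_all [Msg.fal, Msg.subst, Msg.asubst]

theorem Msg.asubst_congr {σ τ : Subst} {M : Msg} (h : ∀ α ∈ M.fal, σ α = τ α) :
    M.asubst σ = M.asubst τ := by
  induction M <;> simp_all [Msg.fal, Msg.asubst]

theorem aliasMap_of_mem {ρ : Alias ≃. Alias} {α β : Alias} (h : ρ α = some β) :
    aliasMap ρ α = .al β := by
  simp [aliasMap, h]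

theorem Msg.asubst_aliasMap_symm {ρ : Alias ≃. Alias} {M : Msg}
    (h : M.fal ⊆ {α | (ρ α).isSome}) :
    (M.asubst (aliasMap ρ)).asubst (aliasMap ρ.symm) = M := by
  induction M with
  | al α =>
    obtain ⟨β, hβ⟩ := Option.isSome_iff_exists.1 (h (Set.mem_singleton α))
    rw [Msg.asubst, aliasMap_of_mem hβ, Msg.asubst,
      aliasMap_of_mem (PEquiv.mem_iff_mem ρ |>.2 hβ)]
  | _ => simp_all [Msg.fal, Msg.asubst]

theorem Msg.fal_asubst_aliasMap_subset {ρ : Alias ≃. Alias} {M : Msg}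
    (h : M.fal ⊆ {α | (ρ α).isSome}) :
    (M.asubst (aliasMap ρ)).fal ⊆ {α | (ρ.symm α).isSome} := by
  induction M with
  | al α =>
    obtain ⟨β, hβ⟩ := Option.isSome_iff_exists.1 (h (Set.mem_singleton α))
    have : ρ.symm β = some α := (PEquiv.mem_iff_mem ρ).2 hβ
    simp [Msg.asubst, aliasMap_of_mem hβ, Msg.fal, this]
  | _ => simp_all [Msg.fal, Msg.asubst]

theorem Step.notMem_dom_of_out {A M α u B} (h : Step A (.out M α) u B) : α ∉ A.dom :=
  let ⟨_, _, _, _, _, _, h, _⟩ := step_out_iff.1 h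
  h

/-- The modal logic is sound for `i`-bisimilarity. By the symmetry of `R` an implication is enough,
also for negated formulas. -/
theorem SatUnder.of_bisimulation {R : IndexedRel} (hR : IsISimulation R)
    (hsymm : ∀ A ρ B, R A ρ B ↔ R B ρ.symm A) {φ : Formula} (hφ : φ.AliasFree)
    {A B : ExtProc} {ρ : Alias ≃. Alias} {s : ℕ → Msg} (hAB : R A ρ B)
    (hs : ∀ i, (s i).fal ⊆ A.dom) (h : SatUnder s A φ) :
    SatUnder (fun i => (s i).asubst (aliasMap ρ)) B φ := by
  induction φ generalizing A B ρ s with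
  | tt => trivial
  | eq M N =>
    have := (hR.static hAB (Msg.fal_subst_subset hs hφ.1) (Msg.fal_subst_subset hs hφ.2)).1 h
    rwa [Msg.asubst_subst _ _ hφ.1, Msg.asubst_subst _ _ hφ.2] at this
  | and φ ψ ih₁ ih₂ => exact ⟨ih₁ hφ.1 hAB hs h.1, ih₂ hφ.2 hAB hs h.2⟩
  | neg φ ih =>
    intro hB
    refine h ?_
    have hs' : ∀ i, (s i).fal ⊆ {α | (ρ α).isSome} := fun i => (hR.bij_dom hAB).symm ▸ hs i
    have := ih hφ ((hsymm _ _ _).1 hAB)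
      (fun i => (hR.bij_ran hAB) ▸ Msg.fal_asubst_aliasMap_subset (hs' i)) hB
    simpa only [Msg.asubst_aliasMap_symm (hs' _)] using this
  | diaTau φ ih =>
    obtain ⟨u, A', hstep, hsat⟩ := h
    obtain ⟨B', u', hstep', hAB'⟩ := hR.nonOutput (π := .tau) hAB id hstep
    have hs' : ∀ i, (s i).fal ⊆ A'.dom := by
      rwa [← hR.bij_dom hAB', hR.bij_dom hAB]
    exact ⟨u', B', hstep', ih hφ hAB' hs' hsat⟩
  | diaInp M N φ ih =>
    obtain ⟨u, A', hstep, hsat⟩ := h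
    obtain ⟨B', u', hstep', hAB'⟩ := hR.nonOutput (π := .inp _ _) hAB id hstep
    have hs' : ∀ i, (s i).fal ⊆ A'.dom := by
      rwa [← hR.bij_dom hAB', hR.bij_dom hAB]
    rw [Label.asubst, Msg.asubst_subst _ _ hφ.1, Msg.asubst_subst _ _ hφ.2.1] at hstep'
    exact ⟨u', B', hstep', ih hφ.2.2 hAB' hs' hsat⟩
  | diaOut M φ ih =>
    obtain ⟨α, u, A', hstep, -, hsat⟩ := h
    obtain ⟨B', u', α', ρ', hstep', hρ', hAB'⟩ := hR.output hAB hstep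
    have hdom : A'.dom = insert α A.dom := by
      rw [← hR.bij_dom hAB', ← hR.bij_dom hAB]
      ext β
      rw [Set.mem_ofPred, hρ' β]
      by_cases hβ : β = α <;> simp [hβ]
    have hs' : ∀ i, (scons (.al α) s i).fal ⊆ A'.dom := by
      intro i
      rw [hdom]
      cases i with
      | zero => simp [Msg.fal]
      | succ i => exact (hs i).trans (Set.subset_insert _ _)
    have hsB : ∀ i, ((s i).asubst (aliasMap ρ)).fal ⊆ B.dom := fun i =>
      (hR.bij_ran hAB) ▸ Msg.fal_asubst_aliasMap_subset ((hR.bij_dom hAB).symm ▸ hs i)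
    rw [Msg.asubst_subst _ _ hφ.1] at hstep'
    refine ⟨α', u', B', hstep', fun hmem => hstep'.notMem_dom_of_out
      (Formula.falUnder_subset (fal_up_subset hsB) hφ.2 hmem), ?_⟩
    convert ih hφ.2 hAB' hs' hsat using 1
    funext i
    cases i with
    | zero => exact (aliasMap_of_mem (by simp [hρ' α])).symm
    | succ i =>
      refine Msg.asubst_congr fun β hβ => ?_
      have : β ≠ α := fun e => hstep.notMem_dom_of_out (e ▸ hs i hβ)
      simp [aliasMap, hρ' β, this]

/-- Bisimilar processes satisfy the same formulas without aliases. -/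
theorem IBisimilar.sat {A B : ExtProc} (h : IBisimilar A B) {φ : Formula} (hφ : φ.AliasFree)
    (hA : Sat A φ) : Sat B φ := by
  obtain ⟨R, hR, hsymm, hAB⟩ := h
  exact SatUnder.of_bisimulation hR hsymm hφ hAB (fun i => Set.empty_subset _) hA

/-! ### The reachable states of the specification -/

/-- The agents occurring in a reachable state of the specification that can still act: readers run
the verifier and ePassports the prover. The index is the variable of the session key `km` that the
agent shares with the other agent of its session. -/
inductive Thread
  /-- a reader waiting for a nonce -/
  | reader (j : ℕ)
  /-- a reader ready to send its encrypted challenge -/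
  | reply (j : ℕ)
  /-- an ePassport that has not acted yet -/
  | card (j : ℕ)
  /-- an ePassport waiting for the challenge of its reader -/
  | wait (j : ℕ)
deriving DecidableEq

/-- Shift the key of an agent into the scope of `n` additional innermost binders. -/
def Thread.shift (n : ℕ) : Thread → Thread
  | .reader j => .reader (j + n)
  | .reply j => .reply (j + n)
  | .card j => .card (j + n)
  | .wait j => .wait (j + n)

/-- Shift a multiset of agents into the scope of `n` additional innermost binders. -/
def shiftThreads (n : ℕ) (S : Multiset Thread) : Multiset Thread := S.map (Thread.shift n)

@[simp] theorem shiftThreads_empty (n : ℕ) : shiftThreads n 0 = 0 := rfl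
@[simp] theorem shiftThreads_cons (n : ℕ) (t : Thread) (S : Multiset Thread) :
    shiftThreads n (t ::ₘ S) = t.shift n ::ₘ shiftThreads n S := Multiset.map_cons ..
@[simp] theorem shiftThreads_singleton (n : ℕ) (t : Thread) :
    shiftThreads n {t} = {t.shift n} := rfl
@[simp] theorem shiftThreads_add (n : ℕ) (S T : Multiset Thread) :
    shiftThreads n (S + T) = shiftThreads n S + shiftThreads n T := Multiset.map_add ..
@[simp] theorem Thread.shift_zero (t : Thread) : t.shift 0 = t := by cases t <;> rfl
@[simp] theorem shiftThreads_zero (S : Multiset Thread) : shiftThreads 0 S = S := by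
  simp [shiftThreads]

theorem wait_mem_shiftThreads {n j : ℕ} {S : Multiset Thread} (h : .wait j ∈ S) :
    .wait (j + n) ∈ shiftThreads n S :=
  Multiset.mem_map_of_mem (Thread.shift n) h

theorem reply_notMem_shiftThreads {n : ℕ} {S : Multiset Thread} (h : ∀ j, .reply j ∉ S) (j : ℕ) :
    .reply j ∉ shiftThreads n S := by
  intro hj
  obtain ⟨t, ht, e⟩ := Multiset.mem_map.1 hj
  cases t <;> simp [Thread.shift] at e
  exact h _ ht

/-- Messages which an ePassport with message authentication key `j` does not accept: names, and
the challenges that are authenticated with another key. -/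
def Rejected (N : Msg) (j : ℕ) : Prop :=
  (∃ x, N = .var x) ∨ ∃ m b, N = .pair m (.mac m (.var b)) ∧ b ≠ j

theorem Rejected.shift {N j} (n : ℕ) (h : Rejected N j) : Rejected (N.shift n) (j + n) := by
  rcases h with ⟨x, rfl⟩ | ⟨m, b, rfl, hb⟩
  · exact .inl ⟨_, rfl⟩
  · exact .inr ⟨m.shift n, b + n, rfl, by omega⟩

theorem Rejected.not_eqE {N j} (h : Rejected N j) :
    ¬ EqE (.snd N) (.mac (.fst N) (.var j)) := by
  intro e
  have := e.nf_eq
  rcases h with ⟨x, rfl⟩ | ⟨m, b, rfl, hb⟩ <;> simp [Msg.nf] at this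
  exact hb this

/-- `Rep c d P S`: the process `P`, a part of a reachable state of the specification on the
channels `c` and `d`, is a parallel composition of the agents in `S`, of replicated or single
sessions that have not started, and of processes that are unable to act. -/
inductive Rep (c d : ℕ) : Proc → Multiset Thread → Prop
  | nil : Rep c d .nil 0
  | reader (m : Msg) (j : ℕ) :
      Rep c d (.inp (.var d) (.nu (.nu (.out (.var (c + 3))
        (.pair m (.mac m (.var (j + 3)))) .nil)))) {.reader j}
  | reply (m : Msg) (j : ℕ) :
      Rep c d (.nu (.nu (.out (.var (c + 2)) (.pair m (.mac m (.var (j + 2)))) .nil))) {.reply j}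
  | card (Q : Proc) (j : ℕ) :
      Rep c d (.nu (.out (.var (c + 1)) (.var 0) (.inp (.var (d + 1))
        (.mat (.snd (.var 0)) (.mac (.fst (.var 0)) (.var (j + 2))) Q)))) {.card j}
  | wait (Q : Proc) (j : ℕ) :
      Rep c d (.inp (.var d)
        (.mat (.snd (.var 0)) (.mac (.fst (.var 0)) (.var (j + 1))) Q)) {.wait j}
  | stuck {N : Msg} {j : ℕ} (Q : Proc) : Rejected N j →
      Rep c d (.mat (.snd N) (.mac (.fst N) (.var j)) Q) 0
  | session : Rep c d (.nu (.nu
      (.par (verifier (c + 2) (d + 2) 1 0) (prover (c + 2) (d + 2) 1 0)))) 0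
  | spec : Rep c d (specMin c d) 0
  | par {P Q : Proc} {S T : Multiset Thread} : Rep c d P S → Rep c d Q T →
      Rep c d (.par P Q) (S + T)

theorem Rep.shift {c d P S} (h : Rep c d P S) (n : ℕ) :
    Rep (c + n) (d + n) (P.shift n) (shiftThreads n S) := by
  induction h with
  | nil => exact .nil
  | reader m j => exact .reader _ _
  | reply m j => exact .reply _ _
  | card Q j => exact .card _ _
  | wait Q j => exact .wait _ _
  | stuck Q h => exact .stuck _ (h.shift n)
  | session => exact .session
  | spec => exact .spec
  | par _ _ h₁ h₂ => rw [shiftThreads_add]; exact .par h₁ h₂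

/-- The effect of an input on the agents, provided that waiting ePassports reject the message:
the number of new names and the agents afterwards. -/
inductive InpStep (S : Multiset Thread) : ℕ → Multiset Thread → Prop
  | reader (j : ℕ) (T : Multiset Thread) : S = .reader j ::ₘ T → InpStep S 0 (.reply j ::ₘ T)
  | wait (j : ℕ) (T : Multiset Thread) : S = .wait j ::ₘ T → InpStep S 0 T
  | session : InpStep S 2 (.reply 0 ::ₘ .card 0 ::ₘ shiftThreads 2 S)

/-- The effect of an output on the agents: the number of new names, the message sent and the
agents afterwards. -/
inductive OutStep (S : Multiset Thread) : ℕ → Msg → Multiset Thread → Prop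
  | reply (j : ℕ) (m : Msg) (T : Multiset Thread) : S = .reply j ::ₘ T →
      OutStep S 2 (.pair m (.mac m (.var (j + 2)))) (shiftThreads 2 T)
  | card (j : ℕ) (T : Multiset Thread) : S = .card j ::ₘ T →
      OutStep S 1 (.var 0) (.wait (j + 1) ::ₘ shiftThreads 1 T)
  | session : OutStep S 3 (.var 0) (.reader 1 ::ₘ .wait 1 ::ₘ shiftThreads 3 S)

theorem InpStep.add {S n S'} (h : InpStep S n S') (T : Multiset Thread) :
    InpStep (S + T) n (S' + shiftThreads n T) := by
  cases h with
  | reader j U e =>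
    subst e
    simpa using InpStep.reader (S := .reader j ::ₘ (U + T)) j (U + T) rfl
  | wait j U e =>
    subst e
    simpa using InpStep.wait (S := .wait j ::ₘ (S' + T)) j (S' + T) rfl
  | session => simpa using InpStep.session (S := S + T)

theorem OutStep.add {S n N S'} (h : OutStep S n N S') (T : Multiset Thread) :
    OutStep (S + T) n N (S' + shiftThreads n T) := by
  cases h with
  | reply j m U e =>
    subst e
    simpa using OutStep.reply (S := .reply j ::ₘ (U + T)) j m (U + T) rfl
  | card j U e =>
    subst e
    simpa using OutStep.card (S := .card j ::ₘ (U + T)) j (U + T) rfl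
  | session => simpa using OutStep.session (S := S + T)

theorem Rep.session_inp {c d M N u A}
    (h : PStep (.nu (.nu (.par (verifier (c + 2) (d + 2) 1 0) (prover (c + 2) (d + 2) 1 0))))
      (.inp M N) u A) :
    A.bound = 2 ∧ Rep (c + 2) (d + 2) A.proc {.reply 0, .card 0} := by
  obtain ⟨B, rfl, h₁⟩ := h.nu_nu_inv
  rcases h₁.par_inv nofun with ⟨v, n, σ, R, h₂, rfl⟩ | ⟨v, n, σ, R, h₂, rfl⟩
  · obtain ⟨_, _, -, e⟩ := h₂.inp_inv
    cases e
    exact ⟨rfl, .par (.reply _ 0) (.card _ 0)⟩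
  · obtain ⟨C, -, h₃⟩ := h₂.nu_inv
    obtain ⟨_, _, e, -⟩ := h₃.out_inv
    cases e

theorem Rep.session_out {c d M l u A}
    (h : PStep (.nu (.nu (.par (verifier (c + 2) (d + 2) 1 0) (prover (c + 2) (d + 2) 1 0))))
      (.out M (rootAlias l)) u A) :
    A.bound = 3 ∧ A.frame (rootAlias l) = .var 0 ∧
      Rep (c + 3) (d + 3) A.proc {.reader 1, .wait 1} := by
  obtain ⟨B, rfl, h₁⟩ := h.nu_nu_inv
  rcases h₁.par_inv nofun with ⟨v, n, σ, R, h₂, rfl⟩ | ⟨v, n, σ, R, h₂, rfl⟩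
  · obtain ⟨_, _, e, -⟩ := h₂.inp_inv
    cases e
  · obtain ⟨C, e, h₃⟩ := h₂.nu_inv
    obtain ⟨_, l', e', rfl⟩ := h₃.out_inv
    cases e
    cases e'
    exact ⟨rfl, by simp [ExtProc.nu, Subst.single], .par (.reader _ 1) (.wait _ 1)⟩

theorem Rep.inp {c d P S M N u A} (h : Rep c d P S) (hst : PStep P (.inp M N) u A)
    (hrej : ∀ j, .wait j ∈ S → Rejected N j) :
    ∃ S', InpStep S A.bound S' ∧ Rep (c + A.bound) (d + A.bound) A.proc S' := by
  induction h generalizing u A with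
  | nil => exact absurd hst PStep.not_nil
  | reader m j =>
    obtain ⟨_, _, e, rfl⟩ := hst.inp_inv
    exact ⟨_, .reader j 0 rfl, .reply _ j⟩
  | reply m j =>
    obtain ⟨B, rfl, h⟩ := hst.nu_nu_inv
    obtain ⟨_, _, e, -⟩ := h.out_inv
    cases e
  | card Q j =>
    obtain ⟨B, rfl, h⟩ := hst.nu_inv
    obtain ⟨_, _, e, -⟩ := h.out_inv
    cases e
  | wait Q j =>
    obtain ⟨_, _, e, rfl⟩ := hst.inp_inv
    cases e
    exact ⟨_, .wait j 0 rfl, .stuck _ (hrej j (Multiset.mem_singleton_self _))⟩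
  | stuck Q h => exact absurd hst.mat_inv.1 h.not_eqE
  | session =>
    obtain ⟨hA, h⟩ := Rep.session_inp hst
    rw [hA]
    exact ⟨_, .session, h⟩
  | spec =>
    refine hst.bang_induction nofun (C := fun A => ∃ S', InpStep 0 A.bound S' ∧
      Rep (c + A.bound) (d + A.bound) A.proc S') (fun v n σ R h => ?_) (fun n σ R h => ?_)
    · obtain ⟨rfl, h⟩ := Rep.session_inp h
      exact ⟨_, .session, .par h (Rep.spec.shift 2)⟩
    · obtain ⟨S', h₁, h₂⟩ := h
      exact ⟨_, by simpa using h₁.add 0, by simpa [add_comm] using (Rep.session.shift n).par h₂⟩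
  | @par P Q S T hP hQ ih₁ ih₂ =>
    rcases hst.par_inv nofun with ⟨v, n, σ, R, h, rfl⟩ | ⟨v, n, σ, R, h, rfl⟩
    · obtain ⟨S', h₁, h₂⟩ := ih₁ h fun j hj => hrej j (Multiset.mem_add.2 (.inl hj))
      exact ⟨_, h₁.add T, h₂.par (hQ.shift n)⟩
    · obtain ⟨S', h₁, h₂⟩ := ih₂ h fun j hj => hrej j (Multiset.mem_add.2 (.inr hj))
      rw [add_comm S T]
      exact ⟨_, h₁.add S, by simpa [add_comm] using (hP.shift n).par h₂⟩

theorem Rep.out {c d P S M l u A} (h : Rep c d P S) (hst : PStep P (.out M (rootAlias l)) u A) :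
    ∃ S', OutStep S A.bound (A.frame (rootAlias l)) S' ∧
      Rep (c + A.bound) (d + A.bound) A.proc S' := by
  induction h generalizing u A with
  | nil => exact absurd hst PStep.not_nil
  | reader m j =>
    obtain ⟨_, _, e, rfl⟩ := hst.inp_inv
    cases e
  | reply m j =>
    obtain ⟨B, rfl, h⟩ := hst.nu_nu_inv
    obtain ⟨_, _, e, rfl⟩ := h.out_inv
    cases e
    exact ⟨_, by simpa [ExtProc.nu, Subst.single] using OutStep.reply (S := {.reply j}) j m 0 rfl,
      .nil⟩
  | card Q j =>
    obtain ⟨B, rfl, h⟩ := hst.nu_inv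
    obtain ⟨_, _, e, rfl⟩ := h.out_inv
    cases e
    exact ⟨_, by simpa [ExtProc.nu, Subst.single] using OutStep.card (S := {.card j}) j 0 rfl,
      .wait _ (j + 1)⟩
  | wait Q j =>
    obtain ⟨_, _, e, rfl⟩ := hst.inp_inv
    cases e
  | stuck Q h => exact absurd hst.mat_inv.1 h.not_eqE
  | session =>
    obtain ⟨hA, hN, h⟩ := Rep.session_out hst
    rw [hA, hN]
    exact ⟨_, .session, h⟩
  | spec =>
    refine hst.bang_induction nofun (C := fun A => ∃ S', OutStep 0 A.bound
      (A.frame (rootAlias l)) S' ∧ Rep (c + A.bound) (d + A.bound) A.proc S')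
      (fun v n σ R h => ?_) (fun n σ R h => ?_)
    · obtain ⟨rfl, hN, h⟩ := Rep.session_out h
      simp only at hN
      simp only [hN]
      exact ⟨_, .session, .par h (Rep.spec.shift 3)⟩
    · obtain ⟨S', h₁, h₂⟩ := h
      exact ⟨_, by simpa using h₁.add 0, by simpa [add_comm] using (Rep.session.shift n).par h₂⟩
  | @par P Q S T hP hQ ih₁ ih₂ =>
    rcases hst.par_inv nofun with ⟨v, n, σ, R, h, rfl⟩ | ⟨v, n, σ, R, h, rfl⟩
    · obtain ⟨S', h₁, h₂⟩ := ih₁ h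
      exact ⟨_, h₁.add T, h₂.par (hQ.shift n)⟩
    · obtain ⟨S', h₁, h₂⟩ := ih₂ h
      rw [add_comm S T]
      exact ⟨_, h₁.add S, by simpa [add_comm] using (hP.shift n).par h₂⟩

/-- A waiting ePassport may consume a message that it rejects, and gets stuck. -/
theorem Rep.exists_wait_inp {c d P S j} {N : Msg} (h : Rep c d P S) (hj : .wait j ∈ S)
    (hN : Rejected N j) :
    ∃ u Q, PStep P (.inp (.var d) N) u ⟨0, Msg.al, Q⟩ ∧ Rep c d Q (S.erase (.wait j)) := by
  induction h with
  | wait Q i =>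
    obtain rfl : j = i := by simpa using hj
    refine ⟨_, _, .inp _ _ (.refl _), ?_⟩
    rw [Multiset.erase_singleton]
    exact .stuck _ hN
  | @par P Q S T hP hQ ih₁ ih₂ =>
    by_cases hS : .wait j ∈ S
    · obtain ⟨u, P', h₁, h₂⟩ := ih₁ hS
      refine ⟨_, _, .parL _ h₁, ?_⟩
      rw [Multiset.erase_add_left_pos _ hS, Proc.shift_zero]
      exact h₂.par hQ
    · obtain ⟨u, Q', h₁, h₂⟩ := ih₂ ((Multiset.mem_add.1 hj).resolve_left hS)
      refine ⟨_, _, .parR _ h₁, ?_⟩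
      rw [Multiset.erase_add_right_neg _ hS, Proc.shift_zero]
      exact hP.par h₂
  | _ => simp at hj

/-! ### The specification does not satisfy the attack formula -/

theorem eq_cons_iff_erase {t : Thread} {S T : Multiset Thread} :
    S = t ::ₘ T ↔ t ∈ S ∧ T = S.erase t :=
  ⟨fun h => h ▸ ⟨Multiset.mem_cons_self _ _, (Multiset.erase_cons_head _ _).symm⟩,
    fun h => h.2 ▸ (Multiset.cons_erase h.1).symm⟩

theorem OutStep.of_ne_var {S n N S'} (h : OutStep S n N S') (hN : ∀ x, N ≠ .var x) :
    ∃ j m, N = .pair m (.mac m (.var (j + 2))) ∧ n = 2 ∧ .reply j ∈ S ∧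
      S' = shiftThreads 2 (S.erase (.reply j)) := by
  cases h with
  | reply j m T e =>
    obtain ⟨hj, rfl⟩ := eq_cons_iff_erase.1 e
    exact ⟨j, m, rfl, rfl, hj, rfl⟩
  | card => exact absurd rfl (hN 0)
  | session => exact absurd rfl (hN 0)

theorem OutStep.ne_al {S n N S'} (h : OutStep S n N S') (α : Alias) : N ≠ .al α := by
  cases h <;> nofun

/-- The possible states after two inputs, when only the first session had started before. -/
theorem InpStep.two_of_first_session {n₁ n₂ : ℕ} {S₁ S₂ : Multiset Thread}
    (h₁ : InpStep {.reader 1, .wait 1} n₁ S₁) (h₂ : InpStep S₁ n₂ S₂) :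
    S₂ = {.reply 1} ∨ S₂ = {.reply 0, .card 0, .reader 3} ∨
      S₂ = {.reply 0, .card 0, .reply 3, .wait 3} ∨
      S₂ = {.reply 0, .card 0, .reply 2, .card 2, .reader 5, .wait 5} := by
  have : S₁ = {.reply 1, .wait 1} ∨ S₁ = {.reader 1} ∨
      S₁ = {.reply 0, .card 0, .reader 3, .wait 3} := by
    cases h₁ with
    | reader j T e =>
      obtain ⟨hj, rfl⟩ := eq_cons_iff_erase.1 e
      obtain rfl : j = 1 := by simpa using hj
      decide
    | wait j T e =>
      obtain ⟨hj, rfl⟩ := eq_cons_iff_erase.1 e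
      obtain rfl : j = 1 := by simpa using hj
      decide
    | session => decide
  cases h₂ with
  | reader j T e =>
    obtain ⟨hj, rfl⟩ := eq_cons_iff_erase.1 e
    rcases this with rfl | rfl | rfl
    · simp at hj
    · obtain rfl : j = 1 := by simpa using hj
      decide
    · obtain rfl : j = 3 := by simpa using hj
      decide
  | wait j T e =>
    obtain ⟨hj, rfl⟩ := eq_cons_iff_erase.1 e
    rcases this with rfl | rfl | rfl
    · obtain rfl : j = 1 := by simpa using hj
      decide
    · simp at hj
    · obtain rfl : j = 3 := by simpa using hj
      decide
  | session => rcases this with rfl | rfl | rfl <;> decide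

/-- After the first session has started, two messages other than names can be sent in response to
two inputs only by two readers, which have different keys. At most one of them belongs to the first
session, whose ePassport rejects the message of the other one; the other ePassports have not
acted yet. -/
theorem rejected_of_two_replies {n₁ n₂ n₃ n₄ : ℕ} {N₁ N₂ : Msg} {S₁ S₂ S₃ S₄ : Multiset Thread}
    (h₁ : InpStep {.reader 1, .wait 1} n₁ S₁) (h₂ : InpStep S₁ n₂ S₂)
    (h₃ : OutStep S₂ n₃ N₁ S₃) (h₄ : OutStep S₃ n₄ N₂ S₄)
    (hN₁ : ∀ x, N₁ ≠ .var x) (hN₂ : ∀ x, N₂ ≠ .var x) :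
    (∀ j, .reply j ∉ S₄) ∧ (∃ j, .wait j ∈ S₄) ∧
      ((∀ j, .wait j ∈ S₄ → Rejected (N₁.shift n₄) j) ∨
        ∀ j, .wait j ∈ S₄ → Rejected N₂ j) := by
  obtain ⟨j₁, m₁, rfl, rfl, hj₁, rfl⟩ := h₃.of_ne_var hN₁
  obtain ⟨j₂, m₂, rfl, rfl, hj₂, rfl⟩ := h₄.of_ne_var hN₂
  have hrej : ∀ {m b j}, b ≠ j → Rejected (.pair m (.mac m (.var b))) j :=
    fun h => .inr ⟨_, _, rfl, h⟩
  rcases h₁.two_of_first_session h₂ with rfl | rfl | rfl | rfl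
  · obtain rfl : j₁ = 1 := by simpa using hj₁
    simp at hj₂
  · obtain rfl : j₁ = 0 := by simpa using hj₁
    simp [Thread.shift] at hj₂
  · obtain rfl | rfl : j₁ = 0 ∨ j₁ = 3 := by simpa using hj₁
    · obtain rfl : j₂ = 5 := by simpa [Thread.shift] using hj₂
      refine ⟨?_, ?_, .inl ?_⟩ <;> simp [Thread.shift, hrej]
    · obtain rfl : j₂ = 2 := by simpa [Thread.shift] using hj₂
      refine ⟨?_, ?_, .inr ?_⟩ <;> simp [Thread.shift, hrej]
  · obtain rfl | rfl : j₁ = 0 ∨ j₁ = 2 := by simpa using hj₁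
    · obtain rfl : j₂ = 4 := by simpa [Thread.shift] using hj₂
      refine ⟨?_, ?_, .inl ?_⟩ <;> simp [Thread.shift, hrej]
    · obtain rfl : j₂ = 2 := by simpa [Thread.shift] using hj₂
      refine ⟨?_, ?_, .inl ?_⟩ <;> simp [Thread.shift, hrej]

/-- The extended process `A` is a state of the specification with the agents `S`; the public
channels `c` and `d` are shifted into the scope of the private names of `A`. -/
def Tracks (c d : ℕ) (A : ExtProc) (S : Multiset Thread) : Prop :=
  Rep (c + A.bound) (d + A.bound) A.proc S

theorem Tracks.inp {c d A S M N u B} (h : Tracks c d A S) (hst : Step A (.inp M N) u B)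
    (hrej : ∀ j, .wait j ∈ S → Rejected ((N.shift A.bound).asubst A.frame) j) :
    ∃ n S', InpStep S n S' ∧ Tracks c d B S' ∧ B.frame = A.frame.shift n := by
  obtain ⟨n, σ, P⟩ := A
  obtain ⟨m, Q, h₁, -, rfl⟩ := step_inp_iff.1 hst
  obtain ⟨S', h₂, h₃⟩ := Rep.inp h h₁ hrej
  exact ⟨m, S', h₂, by simpa [Tracks, add_assoc, add_comm n m] using h₃, rfl⟩

theorem Tracks.out {c d A S M α u B} (h : Tracks c d A S) (hst : Step A (.out M α) u B) :
    ∃ n N S', OutStep S n N S' ∧ Tracks c d B S' ∧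
      B.frame = Function.update (A.frame.shift n) α N := by
  obtain ⟨n, σ, P⟩ := A
  obtain ⟨t, m, N, Q, h₁, -, -, -, rfl⟩ := step_out_iff.1 hst
  obtain ⟨S', h₂, h₃⟩ := Rep.out h h₁
  simp only [Subst.single, Function.update_self] at h₂
  exact ⟨m, N, S', h₂, by simpa [Tracks, add_assoc, add_comm n m] using h₃, rfl⟩

theorem ne_var_of_eqE_pair {N : Msg} (h : EqE (.pair (.fst N) (.snd N)) N) (x : ℕ) :
    N ≠ .var x := by
  rintro rfl
  simpa [Msg.nf] using h.nf_eq

theorem satUnder_isPair_iff {s A i α} (hi : s i = .al α) : SatUnder s A (isPair (.var i)) ↔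
    EqE (.pair (.fst (A.frame α)) (.snd (A.frame α))) (A.frame α) := by
  simp [SatUnder, isPair, ExtProc.SatEq, Msg.subst, Msg.asubst, hi]

/-- Without a reader ready to reply, only names can be sent. -/
theorem Tracks.not_isPair_of_out {c d A S M α u B s} (h : Tracks c d A S)
    (hS : ∀ j, .reply j ∉ S) (hst : Step A (.out M α) u B) :
    ¬ SatUnder (scons (.al α) s) B (isPair (.var 0)) := by
  intro hp
  obtain ⟨n, N, S', h₁, -, h₂⟩ := h.out hst
  rw [satUnder_isPair_iff rfl, h₂, Function.update_self] at hp
  obtain ⟨j, -, -, -, hj, -⟩ := h₁.of_ne_var (ne_var_of_eqE_pair hp)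
  exact hS j hj

/-- As long as some ePassport is waiting, no reader is ready to reply, and the message `α` is
rejected by the waiting ePassports, the attack cannot be continued with `α`: the reply to `α`
would have to come from a reader that has received `α`, and the waiting ePassport may then
consume the next input without any reply. -/
theorem Tracks.not_sat_attackBranch {c d A S s c' d' z z' i a α} (h : Tracks c d A S)
    (hi : s i = .al α) (hd : s d' = .var d) (hz : s z' = .var z) (hwait : .wait a ∈ S)
    (hreply : ∀ j, .reply j ∉ S) (hrej : ∀ j, .wait j ∈ S → Rejected (A.frame α) j) :
    ¬ SatUnder s A (attackBranch c' d' z' i) := by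
  rintro ⟨u, B, hB, β, u', C, hC, -, hw, hbox⟩
  obtain ⟨n, S', h₁, hTB, -⟩ := h.inp hB (by simpa [Msg.subst, hi, Msg.asubst] using hrej)
  obtain ⟨j, T, rfl, hT, b, hb⟩ : ∃ j T, S' = .reply j ::ₘ T ∧ (∀ j, .reply j ∉ T) ∧
      ∃ b, .wait b ∈ T := by
    cases h₁ with
    | reader j T e =>
      subst e
      exact ⟨j, T, rfl, fun k hk => hreply k (Multiset.mem_cons_of_mem hk), a, by simpa using hwait⟩
    | wait j T e =>
      subst e
      exact absurd hw
        (hTB.not_isPair_of_out (fun k hk => hreply k (Multiset.mem_cons_of_mem hk)) hC)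
    | session =>
      refine ⟨0, _, rfl, fun k hk => ?_, a + 2, by simp [wait_mem_shiftThreads hwait]⟩
      rw [Multiset.mem_cons] at hk
      exact reply_notMem_shiftThreads hreply k (hk.resolve_left nofun)
  obtain ⟨n', N, S'', h₂, hTC, hframe⟩ := hTB.out hC
  rw [satUnder_isPair_iff rfl, hframe, Function.update_self] at hw
  obtain ⟨k, -, -, rfl, hk, rfl⟩ := h₂.of_ne_var (ne_var_of_eqE_pair hw)
  obtain rfl : k = j := by
    by_contra hkj
    exact hT k (((Multiset.mem_cons.1 hk).resolve_left (by simpa using hkj)))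
  rw [Multiset.erase_cons_head] at hTC
  have hT' := reply_notMem_shiftThreads (n := 2) hT
  obtain ⟨v, Q, hQ, hTQ⟩ := Rep.exists_wait_inp (N := .var (z + C.bound)) hTC
    (wait_mem_shiftThreads hb) (.inl ⟨_, rfl⟩)
  refine hbox ⟨v, ⟨C.bound, C.frame, Q⟩, ?_, ?_⟩
  · obtain ⟨b, σ, P⟩ := C
    refine step_inp_iff.2 ⟨0, Q, ?_, ?_, ?_⟩
    · simpa [Msg.subst, hd, hz, Msg.asubst] using hQ
    · simp [Msg.subst, hd, hz, Msg.fal]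
    · simp
  · rintro ⟨γ, u'', D, hD, -, hv⟩
    refine Tracks.not_isPair_of_out (A := ⟨C.bound, C.frame, Q⟩) hTQ (fun j hj => ?_) hD hv
    exact hT' j (Multiset.mem_of_mem_erase hj)

theorem specMin_not_sat (c d z : ℕ) :
    ¬ Sat (ExtProc.ofProc (specMin c d)) (attackFormula c d z) := by
  rintro ⟨α, u₁, A₁, hs₁, -, u₂, A₂, hs₂, u₃, A₃, hs₃, α₁, u₄, A₄, hs₄, -, α₂, u₅, A₅, hs₅, -,
    hp₁, hp₂, hb₁, hb₂⟩
  have h₀ : Tracks c d (ExtProc.ofProc (specMin c d)) 0 := .spec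
  obtain ⟨n₁, N, S₁, t₁, h₁, e₁⟩ := h₀.out hs₁
  obtain ⟨rfl, rfl⟩ : N = .var 0 ∧ S₁ = {.reader 1, .wait 1} := by
    cases t₁ with
    | reply _ _ _ e => exact absurd e.symm (Multiset.cons_ne_zero)
    | card _ _ e => exact absurd e.symm (Multiset.cons_ne_zero)
    | session => exact ⟨rfl, rfl⟩
  have hα₁ : A₁.frame α = .var 0 := by rw [e₁, Function.update_self]
  obtain ⟨n₂, S₂, t₂, h₂, e₂⟩ := h₁.inp hs₂ fun _ _ => .inl ⟨0, hα₁⟩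
  have hα₂ : A₂.frame α = .var n₂ := by simp [e₂, Subst.shift, hα₁]
  obtain ⟨n₃, S₃, t₃, h₃, e₃⟩ := h₂.inp hs₃ fun _ _ => .inl ⟨n₂, hα₂⟩
  obtain ⟨n₄, N₁, S₄, t₄, h₄, e₄⟩ := h₃.out hs₄
  obtain ⟨n₅, N₂, S₅, t₅, h₅, e₅⟩ := h₄.out hs₅
  have hN₂ : A₅.frame α₂ = N₂ := by rw [e₅, Function.update_self]
  have hp₁' : EqE (.pair (.fst (A₅.frame α₁)) (.snd (A₅.frame α₁))) (A₅.frame α₁) := hp₁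
  have hp₂' : EqE (.pair (.fst (A₅.frame α₂)) (.snd (A₅.frame α₂))) (A₅.frame α₂) := hp₂
  have hα₁₂ : α₁ ≠ α₂ := by
    rintro rfl
    refine hs₅.notMem_dom_of_out ?_
    change A₄.frame α₁ ≠ .al α₁
    rw [e₄, Function.update_self]
    exact t₄.ne_al α₁
  have hN₁ : A₅.frame α₁ = N₁.shift n₅ := by
    rw [e₅, Function.update_of_ne hα₁₂, Subst.shift, e₄, Function.update_self]
  rw [satUnder_isPair_iff (α := α₁) rfl, hN₁] at hp₁
  rw [satUnder_isPair_iff (α := α₂) rfl, hN₂] at hp₂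
  obtain ⟨hreply, ⟨a, ha⟩, hrej | hrej⟩ := rejected_of_two_replies t₂ t₃ t₄ t₅
    (fun x hx => ne_var_of_eqE_pair hp₁ (x + n₅) (by rw [hx, Msg.shift_var]))
    (ne_var_of_eqE_pair hp₂)
  · refine h₅.not_sat_attackBranch (z := z) ?_ ?_ ?_ ha hreply (hN₁ ▸ hrej) hb₁ <;> rfl
  · refine h₅.not_sat_attackBranch (z := z) ?_ ?_ ?_ ha hreply (hN₂ ▸ hrej) hb₂ <;> rfl

/-! ### Agents of the system and their transitions -/

/-- The message `(m, mac(m, km))` with `m = enc(M, ke)`, where the keys `km` and `ke` are the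
variables `j` and `j + 1`. -/
def authenticated (j : ℕ) (M : Msg) : Msg :=
  .pair (.enc M (.var (j + 1))) (.mac (.enc M (.var (j + 1))) (.var j))

@[simp] theorem authenticated_shift (n j : ℕ) (M : Msg) :
    (authenticated j M).shift n = authenticated (j + n) (M.shift n) := by
  simp [authenticated, Nat.add_right_comm]

/-- The verifier after receiving the nonce `N`. -/
def verifierReply (c j : ℕ) (N : Msg) : Proc :=
  .nu <| .nu <| .out (.var (c + 2))
    (authenticated (j + 2) (.pair (.var 1) (.pair (N.shift 2) (.var 0)))) .nil

/-- The prover after sending the nonce `t`. -/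
def proverWait (c d j t : ℕ) : Proc :=
  .inp (.var d) <|
  .mat (.snd (.var 0)) (.mac (.fst (.var 0)) (.var (j + 1))) <|
  .mat (.var (t + 1)) (.fst (.snd (.dec (.fst (.var 0)) (.var (j + 2))))) <|
  .nu <| .out (.var (c + 2)) (authenticated (j + 2)
    (.pair (.var (t + 2)) (.pair (.fst (.dec (.fst (.var 1)) (.var (j + 3)))) (.var 0)))) .nil

/-- The prover after sending the nonce `t` and receiving `N`. -/
def proverReply (c j t : ℕ) (N : Msg) : Proc :=
  .mat (.snd N) (.mac (.fst N) (.var j)) <|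
  .mat (.var t) (.fst (.snd (.dec (.fst N) (.var (j + 1))))) <|
  .nu <| .out (.var (c + 1)) (authenticated (j + 1) (.pair (.var (t + 1))
    (.pair (.fst (.dec (.fst (N.shift 1)) (.var (j + 2)))) (.var 0)))) .nil

/-- The replicated sessions of the system that share the keys `j` and `j + 1`. -/
def sessions (c d j : ℕ) : Proc :=
  .bang (.par (verifier c d (j + 1) j) (prover c d (j + 1) j))

theorem verifier_shift (n c d ke km : ℕ) :
    (verifier c d ke km).shift n = verifier (c + n) (d + n) (ke + n) (km + n) := by
  simp [verifier, Proc.shift, Proc.rename, Proc.subst, Msg.subst]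

theorem prover_shift (n c d ke km : ℕ) :
    (prover c d ke km).shift n = prover (c + n) (d + n) (ke + n) (km + n) := by
  simp [prover, Proc.shift, Proc.rename, Proc.subst, Msg.subst]

theorem sessions_shift (n c d j : ℕ) :
    (sessions c d j).shift n = sessions (c + n) (d + n) (j + n) := by
  simp [sessions, verifier_shift, prover_shift, Nat.add_right_comm]

theorem systemMin_shift (n c d : ℕ) : (systemMin c d).shift n = systemMin (c + n) (d + n) := rfl

theorem Msg.shift_subst_up (s : ℕ → Msg) (M : Msg) :
    (M.shift 1).subst (up s) = (M.subst s).shift 1 := by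
  simp only [Msg.shift, Msg.subst_subst]
  rfl

theorem verifierReply_shift (n c j : ℕ) (N : Msg) :
    (verifierReply c j N).shift n = verifierReply (c + n) (j + n) (N.shift n) := by
  have : (N.shift 2).subst (up (up fun i => .var (i + n))) = (N.shift n).shift 2 := by
    rw [← Msg.shift_shift 1 1, Msg.shift_subst_up, Msg.shift_subst_up, Msg.shift_shift]
    rfl
  simp [verifierReply, authenticated, Proc.shift, Proc.rename, Proc.subst, Msg.subst, this,
    Nat.add_right_comm]

theorem proverWait_shift (n c d j t : ℕ) :
    (proverWait c d j t).shift n = proverWait (c + n) (d + n) (j + n) (t + n) := by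
  simp [proverWait, authenticated, Proc.shift, Proc.rename, Proc.subst, Msg.subst,
    Nat.add_right_comm]

theorem PStep.nu_out (c l : ℕ) (N : Msg) (P : Proc) :
    PStep (.nu (.out (.var (c + 1)) N P)) (.out (.var c) (rootAlias l)) (.one ⟨[], []⟩)
      ⟨1, Subst.single (rootAlias l) N, P⟩ := by
  have h : PStep (.out (.var (c + 1)) N P) (Label.shift 1 (.out (.var c) (rootAlias l)))
    (.one ⟨[], []⟩) _ := .out N P l (.refl _)
  exact h.ext

theorem PStep.nu_nu_out (c l : ℕ) (N : Msg) (P : Proc) :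
    PStep (.nu (.nu (.out (.var (c + 2)) N P))) (.out (.var c) (rootAlias l)) (.one ⟨[], []⟩)
      ⟨2, Subst.single (rootAlias l) N, P⟩ := by
  have h : PStep (.nu (.out (.var (c + 2)) N P)) (Label.shift 1 (.out (.var c) (rootAlias l)))
    (.one ⟨[], []⟩) _ := .nu_out (c + 1) l N P
  exact h.ext

theorem verifier_step (c d j : ℕ) (N : Msg) :
    PStep (verifier c d (j + 1) j) (.inp (.var d) N) (.one ⟨[], []⟩)
      ⟨0, Msg.al, verifierReply c j N⟩ := by
  unfold verifier
  convert PStep.inp N _ (.refl (.var d)) using 2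
  simp [verifierReply, authenticated, Proc.inst, Proc.subst, Msg.subst]

theorem verifierReply_step (c j l : ℕ) (N : Msg) :
    PStep (verifierReply c j N) (.out (.var c) (rootAlias l)) (.one ⟨[], []⟩)
      ⟨2, Subst.single (rootAlias l)
        (authenticated (j + 2) (.pair (.var 1) (.pair (N.shift 2) (.var 0)))), .nil⟩ :=
  .nu_nu_out c l _ _

theorem prover_step (c d j l : ℕ) :
    PStep (prover c d (j + 1) j) (.out (.var c) (rootAlias l)) (.one ⟨[], []⟩)
      ⟨1, Subst.single (rootAlias l) (.var 0), proverWait (c + 1) (d + 1) (j + 1) 0⟩ :=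
  .nu_out c l _ _

theorem proverWait_step (c d j t : ℕ) (N : Msg) :
    PStep (proverWait c d j t) (.inp (.var d) N) (.one ⟨[], []⟩)
      ⟨0, Msg.al, proverReply c j t N⟩ :=
  PStep.inp N _ (.refl _)

/-- A prover accepts every challenge for its nonce that is authenticated with its own keys, in
particular the challenges of all sessions with the same keys. -/
theorem proverReply_step (c j t l : ℕ) (K L : Msg) :
    ∃ M, PStep (proverReply c j t (authenticated j (.pair K (.pair (.var t) L))))
      (.out (.var c) (rootAlias l)) (.one ⟨[], []⟩)
      ⟨1, Subst.single (rootAlias l) (authenticated (j + 1) M), .nil⟩ := by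
  refine ⟨_, .mat (.mat (.nu_out c l _ _) ?_) ?_⟩
  · exact .symm <| .trans (.fst (.trans (.snd (.trans (.dec (.fst_pair _ _) (.refl _))
      (.dec_enc _ _))) (.snd_pair _ _))) (.fst_pair _ _)
  · exact .trans (.snd_pair _ _) (.symm (.mac (.fst_pair _ _) (.refl _)))

/-! ### States without waiting ePassports -/

/-- Whatever the choice of the alias variable, `P` can send some pair on the channel `c`. -/
def CanSendPair (c : ℕ) (P : Proc) : Prop :=
  ∃ s t n M N Q, ∀ l, PStep P (.out (.var c) (rootAlias l)) (.one ⟨s, t⟩)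
    ⟨n, Subst.single (rootAlias l) (.pair M N), Q⟩

theorem CanSendPair.parL {c P} (h : CanSendPair c P) (Q : Proc) : CanSendPair c (.par P Q) :=
  let ⟨_, _, _, _, _, _, h⟩ := h
  ⟨_, _, _, _, _, _, fun l => (h l).parL Q⟩

theorem CanSendPair.parR {c Q} (h : CanSendPair c Q) (P : Proc) : CanSendPair c (.par P Q) :=
  let ⟨_, _, _, _, _, _, h⟩ := h
  ⟨_, _, _, _, _, _, fun l => (h l).parR P⟩

/-- Processes in which every agent able to perform an input is a verifier. -/
inductive OnlyVerifiersReceive (c d : ℕ) : Proc → Prop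
  | nil : OnlyVerifiersReceive c d .nil
  | prover (ke km : ℕ) : OnlyVerifiersReceive c d (prover c d ke km)
  | sessions (j : ℕ) : OnlyVerifiersReceive c d (sessions c d j)
  | system : OnlyVerifiersReceive c d (systemMin c d)
  | par {P Q : Proc} : OnlyVerifiersReceive c d P → OnlyVerifiersReceive c d Q →
      OnlyVerifiersReceive c d (.par P Q)

theorem sessions_canSendPair {c d j M N u A} (h : PStep (sessions c d j) (.inp M N) u A) :
    CanSendPair (c + A.bound) A.proc := by
  refine h.bang_induction nofun (C := fun A => CanSendPair (c + A.bound) A.proc)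
    (fun v n σ R h => ?_) (fun n σ R h => h.parR _)
  refine CanSendPair.parL ?_ _
  rcases h.par_inv nofun with ⟨v, n, σ, R, h₂, e⟩ | ⟨v, n, σ, R, h₂, -⟩
  · obtain ⟨_, _, -, e'⟩ := h₂.inp_inv
    cases e
    cases e'
    exact CanSendPair.parL ⟨_, _, _, _, _, _, fun l => .nu_nu_out c l _ _⟩ _
  · obtain ⟨C, -, h₃⟩ := h₂.nu_inv
    obtain ⟨_, _, e, -⟩ := h₃.out_inv
    cases e

theorem OnlyVerifiersReceive.canSendPair {c d P M N u A} (h : OnlyVerifiersReceive c d P)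
    (hst : PStep P (.inp M N) u A) : CanSendPair (c + A.bound) A.proc := by
  induction h generalizing u A with
  | nil => exact absurd hst PStep.not_nil
  | prover =>
    obtain ⟨C, -, h⟩ := hst.nu_inv
    obtain ⟨_, _, e, -⟩ := h.out_inv
    cases e
  | sessions => exact sessions_canSendPair hst
  | system =>
    refine hst.bang_induction nofun (C := fun A => CanSendPair (c + A.bound) A.proc)
      (fun v n σ R h => ?_) (fun n σ R h => h.parR _)
    obtain ⟨⟨m, τ, T⟩, e, h₁⟩ := h.nu_nu_inv
    have := sessions_canSendPair (j := 0) h₁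
    cases e
    rw [show c + 2 + m = c + (m + 1 + 1) by omega] at this
    exact this.parL _
  | par _ _ ih₁ ih₂ =>
    rcases hst.par_inv nofun with ⟨v, n, σ, R, h, rfl⟩ | ⟨v, n, σ, R, h, rfl⟩
    · exact (ih₁ h).parL _
    · exact (ih₂ h).parR _

/-! ### The system satisfies the attack formula -/

/-- The aliases in the domain of `σ` have alias variables below `b`. -/
def Below (b : ℕ) (σ : Subst) : Prop := ∀ α, b ≤ α.name → σ α = .al α

theorem Below.shift {b σ} (h : Below b σ) (n : ℕ) : Below b (σ.shift n) := fun α hα => by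
  simp [Subst.shift, h α hα]

theorem Below.update {b σ} (h : Below b σ) (s : List Bool) (N : Msg) :
    Below (b + 1) (Function.update σ ⟨s, b⟩ N) := fun α hα => by
  rw [Function.update_of_ne (fun e => by simp [e] at hα)]
  exact h α (by omega)

theorem PStep.step_out {n σ P c s t l m N Q} (h : PStep P (.out (.var (c + n)) (rootAlias l))
    (.one ⟨s, t⟩) ⟨m, Subst.single (rootAlias l) N, Q⟩) (hσ : Below l σ) :
    Step ⟨n, σ, P⟩ (.out (.var c) ⟨s, l⟩) (.one ⟨s, t⟩)
      ⟨m + n, Function.update (σ.shift m) ⟨s, l⟩ N, Q⟩ :=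
  step_out_iff.2 ⟨t, m, N, Q, h, by simp [Msg.fal], by simp [Subst.dom, hσ ⟨s, l⟩ le_rfl],
    rfl, rfl⟩

theorem PStep.step_inp {n σ P d u α m Q} (h : PStep P (.inp (.var (d + n)) (σ α)) u
    ⟨m, Msg.al, Q⟩) (hα : α ∈ σ.dom) :
    Step ⟨n, σ, P⟩ (.inp (.var d) (.al α)) u ⟨m + n, σ.shift m, Q⟩ :=
  step_inp_iff.2 ⟨m, Q, h, by simpa [Msg.fal] using hα, rfl⟩

/-- If every agent able to receive is a verifier, then after any input some pair can be sent. -/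
theorem sat_boxInp_of_onlyVerifiersReceive {s c' d' z' c d b n σ P}
    (hc : s c' = .var c) (hσ : Below b σ)
    (hP : OnlyVerifiersReceive (c + n) (d + n) P) :
    SatUnder s ⟨n, σ, P⟩
      (.boxInp (.var d') (.var z') (.diaOut (.var c') (isPair (.var 0)))) := by
  rintro ⟨u, B, hB, hn⟩
  refine hn ?_
  obtain ⟨m, Q, h, -, rfl⟩ := step_inp_iff.1 hB
  obtain ⟨s', t, k, M, N, R, hR⟩ := hP.canSendPair h
  have e : Step ⟨m + n, σ.shift m, Q⟩ (.out (.var c) ⟨s', b⟩) _ _ :=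
    PStep.step_out (by simpa [add_assoc, add_comm n m] using hR b) (hσ.shift m)
  refine ⟨⟨s', b⟩, _, _, by simpa only [Msg.subst, hc] using e,
    by simp [isPair, Formula.falUnder, Msg.subst, Msg.fal], (satUnder_isPair_iff rfl).2 ?_⟩
  simp only [Function.update_self]
  exact .pair (.fst_pair _ _) (.snd_pair _ _)

theorem eqE_pair_authenticated (j : ℕ) (M : Msg) :
    EqE (.pair (.fst (authenticated j M)) (.snd (authenticated j M))) (authenticated j M) :=
  .pair (.fst_pair _ _) (.snd_pair _ _)

theorem authenticated_mem_dom {σ : Subst} {α : Alias} {j M} (h : σ α = authenticated j M) :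
    α ∈ σ.dom := by
  change σ α ≠ .al α
  rw [h]
  nofun

theorem notMem_falUnder {s : ℕ → Msg} {b : ℕ} {α : Alias} {φ : Formula}
    (hs : ∀ k, (s k).fal ⊆ {β | β.name < b}) (hα : α.name = b)
    (hφ : φ.AliasFree) : α ∉ φ.falUnder (up s) := fun hmem =>
  absurd (Formula.falUnder_subset (fal_up_subset hs) hφ hmem) (by simp [hα])

theorem fal_scons_subset {s : ℕ → Msg} {b} (hs : ∀ k, (s k).fal ⊆ {β : Alias | β.name < b}) (l : List Bool)
    (k : ℕ) : (scons (.al ⟨l, b⟩) s k).fal ⊆ {β | β.name < b + 1} := by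
  cases k with
  | zero => simp [Msg.fal]
  | succ k => exact (hs k).trans fun β (hβ : β.name < b) => Nat.lt_succ_of_lt hβ

/-- The only waiting prover accepts the challenge `α` and replies, after which only verifiers can
receive. -/
theorem sat_attackBranch_of_proverWait {s c' d' z' i c d b n σ α j t K L C}
    (hc : s c' = .var c) (hd : s d' = .var d) (hi : s i = .al α)
    (hs : ∀ k, (s k).fal ⊆ {β | β.name < b}) (hσ : Below b σ)
    (hα : σ α = authenticated j (.pair K (.pair (.var t) L)))
    (hC : OnlyVerifiersReceive (c + n + 1) (d + n + 1) (C.shift 1)) :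
    SatUnder s ⟨n, σ, .par (.par (.par .nil (proverWait (c + n) (d + n) j t)) C)
      (systemMin (c + n) (d + n))⟩ (attackBranch c' d' z' i) := by
  obtain ⟨M, hM⟩ := proverReply_step (c + n) j t b K L
  have h₁ := (((proverWait_step (c + n) (d + n) j t (σ α)).parR .nil).parL C).parL
    (systemMin (c + n) (d + n))
  rw [hα] at h₁
  have h₂ := ((hM.parR .nil).parL C).parL (systemMin (c + n) (d + n))
  simp only [Proc.shift_zero] at h₁
  rw [← hα] at h₁
  have e₁ := h₁.step_inp (authenticated_mem_dom hα)
  rw [Subst.shift_zero, Nat.zero_add] at e₁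
  have e₂ := h₂.step_out hσ
  refine ⟨_, _, by simpa only [Msg.subst, hd, hi] using e₁, ⟨_, b⟩, _, _,
    by simpa only [Msg.subst, hc, hα] using e₂, fun hmem => ?_, ?_, ?_⟩
  · refine notMem_falUnder hs rfl ?_ hmem
    simp [Formula.AliasFree, isPair, Formula.boxInp, Msg.fal]
  · refine (satUnder_isPair_iff rfl).2 ?_
    simp only [Function.update_self]
    exact eqE_pair_authenticated _ _
  · refine sat_boxInp_of_onlyVerifiersReceive (c := c) (d := d) (b := b + 1) hc
      ((hσ.shift 1).update _ _) ?_
    rw [Nat.add_comm 1 n]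
    exact .par (.par (.par .nil .nil) hC) .system

theorem systemMin_sat (c d z : ℕ) :
    Sat (ExtProc.ofProc (systemMin c d)) (attackFormula c d z) := by
  -- Two sessions with the same keys `1` and `2` are started: the prover of the first one sends its
  -- nonce (`h₁`), which the verifiers of both receive (`h₂`, `h₃`) and answer (`h₄`, `h₅`).
  have h₁ : PStep (systemMin c d) (.out (.var (c + 0)) (rootAlias 0))
      (.one ⟨[false, false, true], []⟩) ⟨3, Subst.single (rootAlias 0) (.var 0),
        .par (.par (.par (verifier (c + 3) (d + 3) 2 1) (proverWait (c + 3) (d + 3) 1 0))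
          (sessions (c + 3) (d + 3) 1)) (systemMin (c + 3) (d + 3))⟩ := by
    have := (((prover_step (c + 2) (d + 2) 0 0).parR (verifier (c + 2) (d + 2) 1 0)).parL
      (sessions (c + 2) (d + 2) 0)).bang
    rw [verifier_shift, sessions_shift] at this
    have := PStep.parL (systemMin c d) (PStep.ext (π := .out (.var c) (rootAlias 0))
      (PStep.ext (π := .out (.var (c + 1)) (rootAlias 0)) this))
    exact this.bang
  have h₂ := (((verifier_step (c + 3) (d + 3) 1 (.var 0)).parL
    (proverWait (c + 3) (d + 3) 1 0)).parL (sessions (c + 3) (d + 3) 1)).parL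
    (systemMin (c + 3) (d + 3))
  have h₃ := ((((verifier_step (c + 3) (d + 3) 1 (.var 0)).parL
    (prover (c + 3) (d + 3) 2 1)).parL (sessions (c + 3) (d + 3) 1)).bang.parR
    (.par (verifierReply (c + 3) 1 (.var 0)) (proverWait (c + 3) (d + 3) 1 0))).parL
    (systemMin (c + 3) (d + 3))
  have h₄ := (((verifierReply_step (c + 3) 1 1 (.var 0)).parL
    (proverWait (c + 3) (d + 3) 1 0)).parL (.par (.par (verifierReply (c + 3) 1 (.var 0))
      (prover (c + 3) (d + 3) 2 1)) (sessions (c + 3) (d + 3) 1))).parL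
    (systemMin (c + 3) (d + 3))
  have h₅ := ((((verifierReply_step (c + 5) 3 2 (.var 2)).parL
    (prover (c + 5) (d + 5) 4 3)).parL (sessions (c + 5) (d + 5) 3)).parR
    (.par .nil (proverWait (c + 5) (d + 5) 3 2))).parL (systemMin (c + 5) (d + 5))
  simp only [Proc.shift_zero] at h₂ h₃
  simp only [Proc.shift_par, Proc.shift_nil, verifierReply_shift, proverWait_shift, prover_shift,
    sessions_shift, systemMin_shift, Msg.shift_var, Nat.reduceAdd, Nat.add_assoc] at h₄ h₅
  -- The corresponding transitions of extended processes; the successive aliases have the alias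
  -- variables `0`, `1` and `2`, and `σ₁`, `σ₂`, `σ₃` are the active substitutions after the outputs.
  have hb₀ : Below 0 Msg.al := fun _ _ => rfl
  have e₁ := h₁.step_out hb₀
  have hb₁ := (hb₀.shift 3).update [false, false, true] (.var 0)
  generalize hσ₁ : Function.update (Subst.shift 3 Msg.al) (⟨[false, false, true], 0⟩ : Alias)
    (.var 0) = σ₁ at e₁ hb₁
  have hα : σ₁ ⟨[false, false, true], 0⟩ = .var 0 := by rw [← hσ₁, Function.update_self]
  have hdom : (⟨[false, false, true], 0⟩ : Alias) ∈ Subst.dom σ₁ := by simp [Subst.dom, hα]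
  rw [← hα] at h₂ h₃
  have e₂ := h₂.step_inp (n := 3) hdom
  have e₃ := h₃.step_inp (n := 3) hdom
  simp only [Subst.shift_zero, Nat.zero_add, hα] at e₂ e₃
  have e₄ := h₄.step_out (n := 3) (s := [false, false, false]) (t := []) hb₁
  have hb₂ := (hb₁.shift 2).update [false, false, false]
    (authenticated 3 (.pair (.var 1) (.pair (.var 2) (.var 0))))
  generalize hσ₂ : Function.update (Subst.shift 2 σ₁) (⟨[false, false, false], 1⟩ : Alias)
    (authenticated 3 (.pair (.var 1) (.pair (.var 2) (.var 0)))) = σ₂ at e₄ hb₂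
  have e₅ := h₅.step_out (n := 5) (s := [false, true, false, false]) (t := []) hb₂
  have hb₃ := (hb₂.shift 2).update [false, true, false, false]
    (authenticated 5 (.pair (.var 1) (.pair (.var 4) (.var 0))))
  generalize hσ₃ : Function.update (Subst.shift 2 σ₂) (⟨[false, true, false, false], 2⟩ : Alias)
    (authenticated 5 (.pair (.var 1) (.pair (.var 4) (.var 0)))) = σ₃ at e₅ hb₃
  -- Both challenges contain the nonce of the first prover, which is now the variable `4`.
  have hα₁ : σ₃ ⟨[false, false, false], 1⟩ =
      authenticated 5 (.pair (.var 3) (.pair (.var 4) (.var 2))) := by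
    rw [← hσ₃, Function.update_of_ne (by simp), Subst.shift, ← hσ₂, Function.update_self]
    simp
  have hα₂ : σ₃ ⟨[false, true, false, false], 2⟩ =
      authenticated 5 (.pair (.var 1) (.pair (.var 4) (.var 0))) := by
    rw [← hσ₃, Function.update_self]
  have hs₀ : ∀ k, (Msg.var k).fal ⊆ {β | β.name < 0} := fun k => Set.empty_subset _
  have hs₁ := fal_scons_subset hs₀ [false, false, true]
  have hs₂ := fal_scons_subset hs₁ [false, false, false]
  have hs₃ := fal_scons_subset hs₂ [false, true, false, false]
  have hC : OnlyVerifiersReceive (c + 7 + 1) (d + 7 + 1)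
      ((((Proc.nil.par (prover (c + 7) (d + 7) 6 5)).par (sessions (c + 7) (d + 7) 5))).shift 1) := by
    simp only [Proc.shift_par, Proc.shift_nil, prover_shift, sessions_shift]
    exact .par (.par .nil (.prover _ _)) (.sessions _)
  refine ⟨_, _, _, e₁, notMem_falUnder hs₀ rfl ?_, _, _, e₂, _, _, e₃,
    _, _, _, e₄, notMem_falUnder hs₁ rfl ?_, _, _, _, e₅, notMem_falUnder hs₂ rfl ?_,
    (satUnder_isPair_iff rfl).2 ?_, (satUnder_isPair_iff rfl).2 ?_,
    sat_attackBranch_of_proverWait (n := 7) rfl rfl rfl hs₃ hb₃ hα₁ hC,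
    sat_attackBranch_of_proverWait (n := 7) rfl rfl rfl hs₃ hb₃ hα₂ hC⟩
  iterate 3 simp [Formula.AliasFree, attackBranch, isPair, Formula.boxInp, Msg.fal]
  · simpa only [hα₁] using eqE_pair_authenticated _ _
  · simpa only [hα₂] using eqE_pair_authenticated _ _

theorem attackFormula_aliasFree (c d z : ℕ) : (attackFormula c d z).AliasFree := by
  simp [attackFormula, Formula.AliasFree, attackBranch, isPair, Formula.boxInp, Msg.fal]

end APi

theorem mainTheorem6 (c d z : ℕ) (hcd : c ≠ d) :
    ¬ APi.IBisimilar (APi.ExtProc.ofProc (APi.systemMin c d))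
        (APi.ExtProc.ofProc (APi.specMin c d)) ∧
    APi.Sat (APi.ExtProc.ofProc (APi.systemMin c d)) (APi.attackFormula c d z) ∧
    ¬ APi.Sat (APi.ExtProc.ofProc (APi.specMin c d)) (APi.attackFormula c d z) ∧
    ¬ (APi.attackFormula c d z).InSimulationFragment := by
  refine ⟨fun h => ?_, APi.systemMin_sat c d z, APi.specMin_not_sat c d z, ?_⟩
  · exact APi.specMin_not_sat c d z
      (h.sat (APi.attackFormula_aliasFree c d z) (APi.systemMin_sat c d z))
  · simp [APi.attackFormula, APi.attackBranch, APi.Formula.InSimulationFragment,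
      APi.Formula.boxInp]
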